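/- Let $g\ge 0$ and $0<a_1<b_1<a_2<b_2<\dots<a_g<b_g$, and put $$E_{\mathbb R}=[0,\infty)\setminus\bigcup_{j=1}^g(a_j,b_j),\qquad \Omega_{\mathbb R}=\mathbb C\setminus E_{\mathbb R}.$$ For $\zeta\in\Omega_{\mathbb R}$ let $w_\zeta:\Omega_{\mathbb R}\to\mathbb D$ be the Ahlfors function of $\Omega_{\mathbb R}$ at $\zeta$, that is, the analytic function with $w_\zeta(\zeta)=0$ and $$w_\zeta'(\zeta)=\sup\{|f'(\zeta)| : f:\Omega_{\mathbb R}\to\mathbb D \text{ analytic},\ f(\zeta)=0\}.$$ Fix $z_0\in\mathbb C$ with $\operatorname{Im}z_0>0$ and define $$\Delta(z)=w_{z_0}(z)\,w_{\overline{z_0}}(z)+\frac{1}{w_{z_0}(z)\,w_{\overline{z_0}}(z)} .$$ Then $\Delta$ extends from $\Omega_{\mathbb R}$ to a real rational function, i.e. a rational function with real coefficients, so that $\Delta(z)=\overline{\Delta(\overline z)}$; the values of the extension on $E_{\mathbb R}$ are the limits of $\Delta$ from $\Omega_{\mathbb R}$. This rational function, again denoted $\Delta$, has the following properties. (i) The function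 $w_{z_0}$ has exactly $g$ zeros $\overline{z_1},\dots,\overline{z_g}$ in the open lower half-plane, counted with multiplicity, and the poles of $\Delta$ in $\mathbb C$, counted with multiplicity, are $z_0,\overline{z_0},z_1,\overline{z_1},\dots,z_g,\overline{z_g}$. (ii) $E_{\mathbb R}=\{z\in\mathbb C : z \text{ is not a pole of } \Delta \text{ and } \Delta(z)\in[-2,2]\}$. (iii) In each of the gaps $(-\infty,0)$ and $(a_j,b_j)$, $1\le j\le g$, $\Delta$ has exactly one critical point (zero of $\Delta'$), and the value of $\Delta$ there is real and greater than $2$. (iv) In each of the bands $(b_j,a_{j+1})$, $0\le j\le g$, where $b_0=0$ and $a_{g+1}=+\infty$, $\Delta$ has exactly one critical point, and the value of $\Delta$ there is $-2$. -/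

import Mathlib

open scoped ComplexConjugate

namespace Denjoy

/-- The competitors in the Ahlfors problem for `(Ω, z₀)`: analytic maps from `Ω` into the open unit
disk that vanish at `z₀`. Values outside `Ω` are irrelevant. -/
def Admissible (Ω : Set ℂ) (z₀ : ℂ) (f : ℂ → ℂ) : Prop :=
  DifferentiableOn ℂ f Ω ∧ Set.MapsTo f Ω (Metric.ball 0 1) ∧ f z₀ = 0

/-- `w` solves the Ahlfors problem for `(Ω, z₀)`, in the normalization `w'(z₀) = sup |f'(z₀)|`. -/
def IsAhlforsFunction (Ω : Set ℂ) (z₀ : ℂ) (w : ℂ → ℂ) : Prop :=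
  Admissible Ω z₀ w ∧
    ∃ M : ℝ, IsLUB {r : ℝ | ∃ f : ℂ → ℂ, Admissible Ω z₀ f ∧ r = ‖deriv f z₀‖} M ∧
      deriv w z₀ = (M : ℂ)

/-- The Ahlfors function of `(Ω, z₀)`; it is determined on `Ω`, and arbitrary outside `Ω`. -/
noncomputable def ahlforsFunction (Ω : Set ℂ) (z₀ : ℂ) : ℂ → ℂ :=
  Classical.epsilon (IsAhlforsFunction Ω z₀)

/-- The closed half-line `[0, ∞)` with the open gaps `(a j, b j)` removed. -/
def realSet {g : ℕ} (a b : Fin g → ℝ) : Set ℝ :=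
  Set.Ici 0 \ ⋃ j, Set.Ioo (a j) (b j)

/-- The same set, as a subset of the complex plane. -/
def complexSet {g : ℕ} (a b : Fin g → ℝ) : Set ℂ :=
  (fun x : ℝ => (x : ℂ)) '' realSet a b

/-- The Denjoy domain complementary to it. -/
def domain {g : ℕ} (a b : Fin g → ℝ) : Set ℂ :=
  (complexSet a b)ᶜ

/-- The product of the Ahlfors functions at `z₀` and at its complex conjugate. -/
noncomputable def ahlforsProduct {g : ℕ} (a b : Fin g → ℝ) (z₀ z : ℂ) : ℂ :=
  ahlforsFunction (domain a b) z₀ z * ahlforsFunction (domain a b) (conj z₀) z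

/-- The discriminant, meaningful at the points of the domain where `ahlforsProduct` is nonzero. -/
noncomputable def discriminant {g : ℕ} (a b : Fin g → ℝ) (z₀ z : ℂ) : ℂ :=
  ahlforsProduct a b z₀ z + 1 / ahlforsProduct a b z₀ z

/-- The interior of the `j`-th band, `j = 0, …, g` (gaps are numbered from `0` to `g - 1` here):
the `0`-th band starts at `0`, band `j + 1` starts at `b j`; the `g`-th band is unbounded, and band
`j < g` ends at `a j`. -/
def band {g : ℕ} (a b : Fin g → ℝ) (j : Fin (g + 1)) : Set ℝ :=
  {x : ℝ | (Fin.cons 0 b : Fin (g + 1) → ℝ) j < x ∧ ∀ h : j.val < g, x < a ⟨j.val, h⟩}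

/-- The value at a complex point of a rational function with real coefficients (it is only used
away from the poles). -/
noncomputable def value (R : RatFunc ℝ) (z : ℂ) : ℂ :=
  R.eval (algebraMap ℝ ℂ) z

/-- `z` is a pole of the rational function `R` (in lowest terms). -/
def IsPole (R : RatFunc ℝ) (z : ℂ) : Prop :=
  Polynomial.aeval z R.denom = 0

/-- `z` is a critical point of `R`: not a pole, and a zero of the derivative. -/
def IsCritical (R : RatFunc ℝ) (z : ℂ) : Prop :=
  ¬ IsPole R z ∧ HasDerivAt (value R) 0 z

end Denjoy

/-!
The idea of the proof is that everything is explicit. Let `F = num / den` be the real rational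
function with simple zeros at the left end points of the bands, simple poles at the right end points
and `F < 0` on the bands. It maps the upper half-plane to the lower one
(`OrderedGaps.quot_im_neg`), because the argument of `-F` is a sum of angles subtended by disjoint
intervals. So `F` has a square root `f` with positive real part on the domain. Put `f₀ = f z₀`. The
Ahlfors function at `z₀` turns out to be

`w = -(f₀ / |f₀|) * (z - z₀) / (z - conj z₀) * (f - conj f₀) / (f + f₀)`.

The numerator of `F - conj (F z₀)` has the zero `conj z₀` and `g` further zeros `ρ k`, all in the
lower half-plane (`OrderedGaps.exists_zeros`). Cancelling the first shows that `w` is analytic, and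
writing `w` on the lower half-plane as a Blaschke product in the `ρ k` times
`(f - f₀) / (f + conj f₀)` shows that `|w| < 1` (`ExtremalData.norm_extremal_lt_one`).

Extremality (`OrderedGaps.norm_deriv_le`) is a duality argument. For a competitor `h`, the function
`h (f + f₀)² / f`, transplanted to the disc from the upper and from the lower half-plane, is
integrated over circles tending to the real line. The contributions of the gaps cancel in the limit,
and on the bands, where `f` is purely imaginary, the moduli of the two kernels add up to the boundary
value of the positive harmonic function `2 (-Im f + |f₀|² Im (1 / f))`, whose mean value is known. The result on
the disc is `norm_mul_norm_deriv_le`; a damping factor makes all integrands bounded. The Ahlfors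
function is unique by a convexity argument (`IsAhlforsFunction.eqOn`), and reflection in the real
axis gives the Ahlfors function at `conj z₀`.

The product of the two functions is therefore
`(f - f₀) (f - conj f₀) / ((f + f₀) (f + conj f₀))`, and the discriminant is
`2 + 16 (Re f₀)² F / ((F - F z₀) (F - conj (F z₀)))`, a rational function of `F`. Its poles are
`z₀`, the `ρ k`, and their conjugates. It takes values in `[-2, 2]` exactly where `F` is in `[-∞, 0]`, that is, on the
given set. Its critical points on the real line, away from the end points, are the points where
`F = |f₀|²` (in the gaps, with a value above `2`) or `F = -|f₀|²` (in the bands, with the value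
`-2`). As `F` is strictly decreasing on each gap and band (`OrderedGaps.wronskianEval_neg`), each
contains just one.
-/

namespace Denjoy

open Complex Metric Set Filter Topology MeasureTheory
open Polynomial hiding map

variable {g : ℕ} {a b : Fin g → ℝ}

/-! ### The extremal estimate on the disc -/

/-- The damping factor `1 / (1 + δ (q + 1/q))`. It is bounded by `1` on the right half-plane and
small near `q = 0` and near `q = ∞`. -/
noncomputable def damping (δ : ℝ) (q : ℂ) : ℂ := (1 + δ * (q + q⁻¹))⁻¹

/-- The damped dual kernel: `(q + c)² / q` times the damping factor. -/
noncomputable def dampedKernel (δ : ℝ) (c q : ℂ) : ℂ := (q + c) ^ 2 / q * damping δ q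

lemma re_add_inv_nonneg {q : ℂ} (hq : 0 ≤ q.re) : 0 ≤ (q + q⁻¹).re := by
  rw [add_re, inv_re]
  have := div_nonneg hq (normSq_nonneg q)
  linarith

lemma one_le_re_damping_inv {δ : ℝ} (hδ : 0 ≤ δ) {q : ℂ} (hq : 0 ≤ q.re) :
    1 ≤ (1 + δ * (q + q⁻¹) : ℂ).re := by
  have := mul_nonneg hδ (re_add_inv_nonneg hq)
  rw [add_re, re_ofReal_mul, one_re]
  linarith

lemma damping_den_ne_zero {δ : ℝ} (hδ : 0 ≤ δ) {q : ℂ} (hq : 0 ≤ q.re) :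
    (1 + δ * (q + q⁻¹) : ℂ) ≠ 0 := by
  intro h
  have := one_le_re_damping_inv hδ hq
  rw [h, zero_re] at this
  linarith

lemma norm_damping_le_one {δ : ℝ} (hδ : 0 ≤ δ) {q : ℂ} (hq : 0 ≤ q.re) : ‖damping δ q‖ ≤ 1 := by
  rw [damping, norm_inv]
  exact inv_le_one_of_one_le₀ ((one_le_re_damping_inv hδ hq).trans (re_le_norm _))

lemma norm_add_inv_mul_norm_damping_le {δ : ℝ} (hδ : 0 < δ) {q : ℂ} (hq : 0 ≤ q.re) :
    ‖q + q⁻¹‖ * ‖damping δ q‖ ≤ 1 / δ := by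
  have h0 : 0 < ‖(1 + δ * (q + q⁻¹) : ℂ)‖ := norm_pos_iff.mpr (damping_den_ne_zero hδ.le hq)
  rw [damping, norm_inv, ← div_eq_mul_inv, div_le_div_iff₀ h0 hδ, one_mul]
  -- `|1 + δ s| ≥ |δ s|` when `Re s ≥ 0`
  have h1 : ‖q + q⁻¹‖ * δ = ‖(δ * (q + q⁻¹) : ℂ)‖ := by
    rw [norm_mul, norm_real, Real.norm_of_nonneg hδ.le, mul_comm]
  rw [h1]
  have h2 : 0 ≤ (δ * (q + q⁻¹) : ℂ).re := by
    rw [re_ofReal_mul]; exact mul_nonneg hδ.le (re_add_inv_nonneg hq)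
  generalize (δ * (q + q⁻¹) : ℂ) = s at h2
  rw [norm_def, norm_def]
  apply Real.sqrt_le_sqrt
  simp only [normSq_apply, add_re, one_re, add_im, one_im]
  nlinarith

lemma norm_mul_norm_damping_le {δ : ℝ} (hδ : 0 < δ) {q : ℂ} (hq : 0 < q.re) :
    ‖q‖ * ‖damping δ q‖ ≤ 1 + 1 / δ ∧ ‖q‖⁻¹ * ‖damping δ q‖ ≤ 1 + 1 / δ := by
  have h1 := norm_damping_le_one hδ.le hq.le
  have h2 := norm_add_inv_mul_norm_damping_le hδ hq.le
  have hq0 : 0 < ‖q‖ := norm_pos_iff.mpr (fun h => by simp [h] at hq)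
  have h3 : ‖q‖ ≤ ‖q + q⁻¹‖ + ‖q‖⁻¹ := by
    have := norm_sub_le (q + q⁻¹) q⁻¹
    rwa [add_sub_cancel_right, norm_inv] at this
  have h4 : ‖q‖⁻¹ ≤ ‖q + q⁻¹‖ + ‖q‖ := by
    have := norm_sub_le (q + q⁻¹) q
    rwa [add_sub_cancel_left, norm_inv] at this
  have hd : 0 ≤ 1 / δ := by positivity
  have hn := norm_nonneg (damping δ q)
  rcases le_total ‖q‖ 1 with hle | hle
  · have : ‖q‖ * ‖damping δ q‖ ≤ 1 := mul_le_one₀ hle hn h1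
    refine ⟨by linarith, ?_⟩
    have := mul_le_mul_of_nonneg_right h4 hn
    linarith
  · have : ‖q‖⁻¹ * ‖damping δ q‖ ≤ 1 := mul_le_one₀ (inv_le_one_of_one_le₀ hle) hn h1
    refine ⟨?_, by linarith⟩
    have := mul_le_mul_of_nonneg_right h3 hn
    linarith

lemma norm_dampedKernel_le {δ : ℝ} (hδ : 0 < δ) (c : ℂ) {q : ℂ} (hq : 0 < q.re) :
    ‖dampedKernel δ c q‖ ≤ (1 + ‖c‖ ^ 2) * (1 + 1 / δ) + 2 * ‖c‖ := by
  have hq0 : q ≠ 0 := fun h => by simp [h] at hq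
  have h1 := norm_damping_le_one hδ.le hq.le
  obtain ⟨h2, h3⟩ := norm_mul_norm_damping_le hδ hq
  have he : (q + c) ^ 2 / q = q + 2 * c + c ^ 2 * q⁻¹ := by field_simp; ring
  rw [dampedKernel, he, norm_mul]
  have h4 : ‖q + 2 * c + c ^ 2 * q⁻¹‖ ≤ ‖q‖ + 2 * ‖c‖ + ‖c‖ ^ 2 * ‖q‖⁻¹ := by
    refine (norm_add₃_le).trans ?_
    simp
  have hn := norm_nonneg (damping δ q)
  calc _ ≤ (‖q‖ + 2 * ‖c‖ + ‖c‖ ^ 2 * ‖q‖⁻¹) * ‖damping δ q‖ := mul_le_mul_of_nonneg_right h4 hn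
    _ = ‖q‖ * ‖damping δ q‖ + 2 * ‖c‖ * ‖damping δ q‖
        + ‖c‖ ^ 2 * (‖q‖⁻¹ * ‖damping δ q‖) := by ring
    _ ≤ (1 + 1 / δ) + 2 * ‖c‖ * 1 + ‖c‖ ^ 2 * (1 + 1 / δ) := by gcongr
    _ = _ := by ring

lemma continuousAt_damping {δ : ℝ} (hδ : 0 ≤ δ) {q : ℂ} (hq : 0 ≤ q.re) (h0 : q ≠ 0) :
    ContinuousAt (damping δ) q := by
  unfold damping
  exact ContinuousAt.inv₀ (by fun_prop (disch := assumption)) (damping_den_ne_zero hδ hq)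

lemma continuousAt_dampedKernel {δ : ℝ} (hδ : 0 ≤ δ) (c : ℂ) {q : ℂ} (hq : 0 ≤ q.re)
    (h0 : q ≠ 0) : ContinuousAt (dampedKernel δ c) q := by
  unfold dampedKernel
  exact ContinuousAt.mul (by fun_prop (disch := assumption)) (continuousAt_damping hδ hq h0)

lemma differentiableOn_dampedKernel_comp {δ : ℝ} (hδ : 0 ≤ δ) (c : ℂ) {p : ℂ → ℂ} {s : Set ℂ}
    (hp : DifferentiableOn ℂ p s) (hre : ∀ u ∈ s, 0 < (p u).re) :
    DifferentiableOn ℂ (fun u => dampedKernel δ c (p u)) s := by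
  have h0 : ∀ u ∈ s, p u ≠ 0 := fun u hu h => by simpa [h] using hre u hu
  unfold dampedKernel damping
  refine DifferentiableOn.mul (DifferentiableOn.div (by fun_prop) hp h0) ?_
  refine DifferentiableOn.inv ?_ (fun u hu => damping_den_ne_zero hδ (hre u hu).le)
  exact ((hp.add (hp.inv h0)).const_mul _).const_add _

lemma integral_circleMap_eq {f : ℂ → ℂ} (hf : DifferentiableOn ℂ f (ball 0 1)) {r : ℝ}
    (h0 : 0 < r) (h1 : r < 1) :
    ∫ θ in (0 : ℝ)..2 * Real.pi, f (circleMap 0 r θ) = 2 * Real.pi * f 0 := by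
  have hd : DiffContOnCl ℂ f (ball 0 |r|) := by
    rw [abs_of_pos h0]
    exact (hf.mono (closedBall_subset_ball h1)).diffContOnCl_ball subset_rfl
  have := hd.circleAverage
  rw [Real.circleAverage_def] at this
  have hpi : (2 * Real.pi : ℂ) ≠ 0 := by simp [Real.pi_ne_zero]
  rw [← this, Complex.real_smul]
  push_cast
  field_simp

lemma continuous_comp_circleMap {E : Type*} [TopologicalSpace E] {f : ℂ → E}
    (hf : ContinuousOn f (ball 0 1)) {r : ℝ}
    (h0 : 0 < r) (h1 : r < 1) : Continuous fun θ : ℝ => f (circleMap 0 r θ) := by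
  refine hf.comp_continuous (continuous_circleMap 0 r) (fun θ => ?_)
  simpa [abs_of_pos h0] using h1

/-- On the negative imaginary axis the two dual kernels add up to the boundary values of the
positive harmonic function `2 (-Im p + |c|² Im (1/p))`. -/
lemma norm_sq_add_norm_sq_div_eq {c q : ℂ} (hre : q.re = 0) (him : q.im < 0) :
    (‖q + c‖ ^ 2 + ‖q + conj c‖ ^ 2) / ‖q‖ = 2 * (-q.im + ‖c‖ ^ 2 * (q⁻¹).im) := by
  have h1 : ‖q‖ = -q.im := by
    rw [norm_def, normSq_apply, hre, show (0:ℝ) * 0 + q.im * q.im = (-q.im) ^ 2 by ring,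
      Real.sqrt_sq (by linarith)]
  have h2 : (-q.im) ≠ 0 := by linarith
  have h3 : q.im ≠ 0 := him.ne
  rw [inv_im, ← Complex.sq_norm q, h1, div_eq_iff h2]
  simp only [Complex.sq_norm, normSq_apply, add_re, add_im, conj_re, conj_im, hre]
  field_simp
  ring

lemma tendsto_circleMap_radius (θ : ℝ) :
    Tendsto (fun r : ℝ => circleMap 0 r θ) (𝓝[<] 1) (𝓝 (circleMap 0 1 θ)) := by
  have : Continuous fun r : ℝ => circleMap 0 r θ := by unfold circleMap; fun_prop
  exact (this.tendsto 1).mono_left nhdsWithin_le_nhds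

lemma eventually_mem_Ioo_half_one : ∀ᶠ r : ℝ in 𝓝[<] 1, r ∈ Ioo (1 / 2 : ℝ) 1 :=
  Ioo_mem_nhdsLT (by norm_num)

/-- The damped form of the extremal estimate on the disc. -/
lemma norm_deriv_mul_norm_dampedKernel_le {p h k : ℂ → ℂ}
    (hp : DifferentiableOn ℂ p (ball 0 1)) (hre : ∀ u ∈ ball (0 : ℂ) 1, 0 < (p u).re)
    (him : ∀ u ∈ ball (0 : ℂ) 1, (p u).im < 0)
    (hh : DifferentiableOn ℂ h (ball 0 1)) (hh1 : ∀ u ∈ ball (0 : ℂ) 1, ‖h u‖ ≤ 1) (h0 : h 0 = 0)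
    (hk : DifferentiableOn ℂ k (ball 0 1)) (hk1 : ∀ u ∈ ball (0 : ℂ) 1, ‖k u‖ ≤ 1)
    (hbd : ∀ᵐ θ : ℝ, ∃ q : ℂ, Tendsto (fun r : ℝ => p (circleMap 0 r θ)) (𝓝[<] 1) (𝓝 q) ∧
      q ≠ 0 ∧ (q.re = 0 ∨ (q.im = 0 ∧
        Tendsto (fun r : ℝ => h (circleMap 0 r θ) - conj (k (circleMap 0 r θ)))
          (𝓝[<] 1) (𝓝 0)))) {δ : ℝ} (hδ : 0 < δ) :
    ‖deriv h 0‖ * ‖dampedKernel δ (p 0) (p 0)‖ ≤ -4 * (p 0).im := by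
  have m0 : (0 : ℂ) ∈ ball (0 : ℂ) 1 := by simp
  have hb : ball (0 : ℂ) 1 ∈ 𝓝 (0 : ℂ) := isOpen_ball.mem_nhds m0
  have hmem : ∀ {r : ℝ}, r ∈ Ioo (1 / 2 : ℝ) 1 → ∀ θ, circleMap 0 r θ ∈ ball (0 : ℂ) 1 := by
    intro r hr θ
    have : 0 < r := by linarith [hr.1]
    simpa [abs_of_pos this] using hr.2
  set c := p 0 with hc
  have hp0 : ∀ u ∈ ball (0 : ℂ) 1, p u ≠ 0 := fun u hu h => by simpa [h] using hre u hu
  set K : ℝ := (1 + ‖c‖ ^ 2) * (1 + 1 / δ) + 2 * ‖c‖ with hK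
  have hK0 : 0 ≤ K := by positivity
  let A : ℂ → ℂ := fun u => dampedKernel δ c (p u)
  let B : ℂ → ℂ := fun u => dampedKernel δ (conj c) (p u)
  have hA : DifferentiableOn ℂ A (ball 0 1) := differentiableOn_dampedKernel_comp hδ.le _ hp hre
  have hB : DifferentiableOn ℂ B (ball 0 1) := differentiableOn_dampedKernel_comp hδ.le _ hp hre
  have hAK : ∀ u ∈ ball (0 : ℂ) 1, ‖A u‖ ≤ K := fun u hu => norm_dampedKernel_le hδ c (hre u hu)
  have hBK : ∀ u ∈ ball (0 : ℂ) 1, ‖B u‖ ≤ K := fun u hu => by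
    have := norm_dampedKernel_le hδ (conj c) (hre u hu)
    rwa [norm_conj] at this
  -- `U` is `h A / u`; the function `V` has mean value zero because it vanishes at the origin
  let U : ℂ → ℂ := dslope (fun u => h u * A u) 0
  let V : ℂ → ℂ := fun u => u * (k u * B u)
  have hU : DifferentiableOn ℂ U (ball 0 1) := (differentiableOn_dslope hb).mpr (hh.mul hA)
  have hV : DifferentiableOn ℂ V (ball 0 1) := differentiableOn_id.mul (hk.mul hB)
  have hU0 : U 0 = deriv h 0 * A 0 := by
    have h1 := (hh.differentiableAt hb).hasDerivAt.mul (hA.differentiableAt hb).hasDerivAt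
    have : U 0 = deriv (fun u => h u * A u) 0 := dslope_same _ _
    rw [this]
    refine (h1.deriv).trans ?_
    simp [h0]
  have hUu : ∀ u, u ≠ 0 → U u = h u * A u / u := by
    intro u hu
    simp only [U]
    rw [dslope_of_ne _ hu, slope_def_field]
    simp [h0]
  -- on a gap both terms of `Y` have the same boundary values
  let Y : ℝ → ℝ → ℂ := fun r θ => U (circleMap 0 r θ) - conj (V (circleMap 0 r θ))
  -- the positive harmonic function dominating the integrand up to a small error
  let S : ℂ → ℝ := fun q => -q.im + ‖c‖ ^ 2 * (q⁻¹).im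
  have hS0 : ∀ u ∈ ball (0 : ℂ) 1, 0 ≤ S (p u) := by
    intro u hu
    have h1 := him u hu
    have h2 : 0 ≤ ((p u)⁻¹).im := by
      rw [inv_im]; exact div_nonneg (by linarith) (normSq_nonneg _)
    have h3 := mul_nonneg (sq_nonneg ‖c‖) h2
    simp only [S]
    linarith
  let e : ℝ → ℝ → ℝ := fun r θ =>
    max 0 (‖Y r θ‖ - 2 * ‖damping δ (p (circleMap 0 r θ))‖ * S (p (circleMap 0 r θ)))
  have hYA : ∀ {r : ℝ}, r ∈ Ioo (1 / 2 : ℝ) 1 → ∀ θ, ‖Y r θ‖ ≤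
      ‖A (circleMap 0 r θ)‖ / r + r * ‖B (circleMap 0 r θ)‖ := by
    intro r hr θ
    have hr0 : 0 < r := by linarith [hr.1]
    have hu := hmem hr θ
    have hn : ‖circleMap 0 r θ‖ = r := by simp [abs_of_pos hr0]
    have hne : circleMap 0 r θ ≠ 0 := circleMap_ne_center hr0.ne'
    refine (norm_sub_le _ _).trans ?_
    rw [hUu _ hne, norm_conj, norm_div, norm_mul, norm_mul, norm_mul, hn]
    gcongr
    · exact mul_le_of_le_one_left (norm_nonneg _) (hh1 _ hu)
    · exact mul_le_of_le_one_left (norm_nonneg _) (hk1 _ hu)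
  have hYK : ∀ {r : ℝ}, r ∈ Ioo (1 / 2 : ℝ) 1 → ∀ θ, ‖Y r θ‖ ≤ 3 * K := by
    intro r hr θ
    refine (hYA hr θ).trans ?_
    have hr0 : 0 < r := by linarith [hr.1]
    have h1 : ‖A (circleMap 0 r θ)‖ / r ≤ 2 * K := by
      rw [div_le_iff₀ hr0]
      nlinarith [hAK _ (hmem hr θ), hr.1]
    have h2 : r * ‖B (circleMap 0 r θ)‖ ≤ 1 * K :=
      mul_le_mul hr.2.le (hBK _ (hmem hr θ)) (norm_nonneg _) zero_le_one
    linarith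
  have he0 : ∀ r θ, 0 ≤ e r θ := fun r θ => le_max_left _ _
  have heY : ∀ {r : ℝ}, r ∈ Ioo (1 / 2 : ℝ) 1 → ∀ θ, e r θ ≤ ‖Y r θ‖ := by
    intro r hr θ
    refine max_le (norm_nonneg _) ?_
    have := mul_nonneg (mul_nonneg zero_le_two (norm_nonneg (damping δ (p (circleMap 0 r θ)))))
      (hS0 _ (hmem hr θ))
    linarith
  have hYe : ∀ {r : ℝ}, r ∈ Ioo (1 / 2 : ℝ) 1 → ∀ θ,
      ‖Y r θ‖ ≤ 2 * S (p (circleMap 0 r θ)) + e r θ := by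
    intro r hr θ
    have h1 : ‖Y r θ‖ - 2 * ‖damping δ (p (circleMap 0 r θ))‖ * S (p (circleMap 0 r θ)) ≤ e r θ :=
      le_max_right _ _
    have h2 := mul_le_mul_of_nonneg_right (norm_damping_le_one hδ.le (hre _ (hmem hr θ)).le)
      (hS0 _ (hmem hr θ))
    linarith
  -- continuity on circles
  have hYc : ∀ {r : ℝ}, r ∈ Ioo (1 / 2 : ℝ) 1 → Continuous (Y r) := by
    intro r hr
    have hr0 : 0 < r := by linarith [hr.1]
    exact (continuous_comp_circleMap hU.continuousOn hr0 hr.2).sub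
      (continuous_conj.comp (continuous_comp_circleMap hV.continuousOn hr0 hr.2))
  have hpc : ContinuousOn p (ball 0 1) := hp.continuousOn
  have hSc : ContinuousOn (fun u => S (p u)) (ball 0 1) :=
    (continuous_im.comp_continuousOn hpc).neg.add
      ((continuous_im.comp_continuousOn (hpc.inv₀ hp0)).const_mul _)
  have hdc : ContinuousOn (fun u => ‖damping δ (p u)‖) (ball 0 1) := fun u hu =>
    ((continuousAt_damping hδ.le (hre u hu).le (hp0 u hu)).comp_continuousWithinAt
      (hpc u hu)).norm
  have hec : ∀ {r : ℝ}, r ∈ Ioo (1 / 2 : ℝ) 1 → Continuous (e r) := by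
    intro r hr
    have hr0 : 0 < r := by linarith [hr.1]
    exact continuous_const.max ((hYc hr).norm.sub ((continuous_const.mul
      (continuous_comp_circleMap hdc hr0 hr.2)).mul (continuous_comp_circleMap hSc hr0 hr.2)))
  -- mean values
  have hYint : ∀ {r : ℝ}, r ∈ Ioo (1 / 2 : ℝ) 1 →
      ∫ θ in (0 : ℝ)..2 * Real.pi, Y r θ = 2 * Real.pi * (deriv h 0 * A 0) := by
    intro r hr
    have hr0 : 0 < r := by linarith [hr.1]
    have c1 := continuous_comp_circleMap hU.continuousOn hr0 hr.2
    have c2 := continuous_conj.comp (continuous_comp_circleMap hV.continuousOn hr0 hr.2)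
    have h1 : ∫ θ in (0 : ℝ)..2 * Real.pi, conj (V (circleMap 0 r θ)) = 0 := by
      rw [intervalIntegral.integral_of_le (by positivity), integral_conj,
        ← intervalIntegral.integral_of_le (by positivity), integral_circleMap_eq hV hr0 hr.2]
      simp [V]
    have h2 := integral_circleMap_eq hU hr0 hr.2
    have h3 := intervalIntegral.integral_sub (μ := volume) (c1.intervalIntegrable 0 (2 * Real.pi))
      (c2.intervalIntegrable 0 (2 * Real.pi))
    rw [hU0] at h2
    rw [h2] at h3
    simp only [Function.comp_def] at h3
    rw [h1, sub_zero] at h3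
    exact h3
  have hSint : ∀ {r : ℝ}, r ∈ Ioo (1 / 2 : ℝ) 1 →
      ∫ θ in (0 : ℝ)..2 * Real.pi, S (p (circleMap 0 r θ)) = 2 * Real.pi * (-2 * c.im) := by
    intro r hr
    have hr0 : 0 < r := by linarith [hr.1]
    have hinv : DifferentiableOn ℂ (fun u => (‖c‖ ^ 2 : ℝ) * (p u)⁻¹ - p u) (ball 0 1) :=
      ((hp.inv hp0).const_mul _).sub hp
    have h1 := integral_circleMap_eq hinv hr0 hr.2
    have c1 := continuous_comp_circleMap hinv.continuousOn hr0 hr.2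
    have h3 : ∫ θ in (0 : ℝ)..2 * Real.pi, S (p (circleMap 0 r θ)) =
        (∫ θ in (0 : ℝ)..2 * Real.pi, ((‖c‖ ^ 2 : ℝ) * (p (circleMap 0 r θ))⁻¹
          - p (circleMap 0 r θ))).im := by
      have := Complex.imCLM.intervalIntegral_comp_comm (μ := volume)
        (c1.intervalIntegrable 0 (2 * Real.pi))
      rw [← Complex.imCLM_apply, ← this]
      refine intervalIntegral.integral_congr (fun θ _ => ?_)
      simp only [S, Complex.imCLM_apply, sub_im, im_ofReal_mul]
      ring
    rw [h3, h1]
    have hcne : c ≠ 0 := hp0 0 m0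
    have hns : normSq c ≠ 0 := by simpa using hcne
    have h4 : (2 * Real.pi * ((‖c‖ ^ 2 : ℝ) * (p 0)⁻¹ - p 0) : ℂ) =
        ((2 * Real.pi : ℝ) : ℂ) * (((‖c‖ ^ 2 : ℝ) : ℂ) * c⁻¹ - c) := by
      push_cast; rfl
    rw [h4, im_ofReal_mul, sub_im, im_ofReal_mul, inv_im, Complex.sq_norm]
    field_simp
    ring
  -- the error tends to zero almost everywhere
  have hlim : ∀ᵐ θ : ℝ, Tendsto (fun r => e r θ) (𝓝[<] 1) (𝓝 0) := by
    filter_upwards [hbd] with θ hθ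
    obtain ⟨q, hq, hq0, hcase⟩ := hθ
    have hqre : 0 ≤ q.re := by
      refine ge_of_tendsto ((continuous_re.tendsto q).comp hq) ?_
      filter_upwards [eventually_mem_Ioo_half_one] with r hr using (hre _ (hmem hr θ)).le
    have hqim : q.im ≤ 0 := by
      refine le_of_tendsto ((continuous_im.tendsto q).comp hq) ?_
      filter_upwards [eventually_mem_Ioo_half_one] with r hr using (him _ (hmem hr θ)).le
    have hAq : Tendsto (fun r => A (circleMap 0 r θ)) (𝓝[<] 1) (𝓝 (dampedKernel δ c q)) :=
      (continuousAt_dampedKernel hδ.le c hqre hq0).tendsto.comp hq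
    have hBq : Tendsto (fun r => B (circleMap 0 r θ)) (𝓝[<] 1)
        (𝓝 (dampedKernel δ (conj c) q)) :=
      (continuousAt_dampedKernel hδ.le (conj c) hqre hq0).tendsto.comp hq
    have hid : Tendsto (fun r : ℝ => r) (𝓝[<] 1) (𝓝 1) := nhdsWithin_le_nhds
    rcases hcase with hcase | ⟨hcase, hhk⟩
    · have hqim' : q.im < 0 := lt_of_le_of_ne hqim fun h => hq0 (Complex.ext hcase h)
      have hdq : Tendsto (fun r => ‖damping δ (p (circleMap 0 r θ))‖) (𝓝[<] 1)
          (𝓝 ‖damping δ q‖) :=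
        ((continuousAt_damping hδ.le hqre hq0).tendsto.comp hq).norm
      have hSq : Tendsto (fun r => S (p (circleMap 0 r θ))) (𝓝[<] 1) (𝓝 (S q)) := by
        refine Tendsto.add ((continuous_im.tendsto q).comp hq).neg (Tendsto.const_mul _ ?_)
        exact (continuous_im.tendsto _).comp (hq.inv₀ hq0)
      have hmaj : Tendsto (fun r => max 0 (‖A (circleMap 0 r θ)‖ / r
          + r * ‖B (circleMap 0 r θ)‖
          - 2 * ‖damping δ (p (circleMap 0 r θ))‖ * S (p (circleMap 0 r θ)))) (𝓝[<] 1)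
          (𝓝 (max 0 (‖dampedKernel δ c q‖ / 1 + 1 * ‖dampedKernel δ (conj c) q‖
            - 2 * ‖damping δ q‖ * S q))) :=
        tendsto_const_nhds.max (((hAq.norm.div hid one_ne_zero).add (hid.mul hBq.norm)).sub
          ((hdq.const_mul 2).mul hSq))
      have hz : ‖dampedKernel δ c q‖ / 1 + 1 * ‖dampedKernel δ (conj c) q‖
            - 2 * ‖damping δ q‖ * S q = 0 := by
        have := norm_sq_add_norm_sq_div_eq (c := c) hcase hqim'
        simp only [dampedKernel, norm_mul, norm_div, norm_pow]
        have hS : S q = (‖q + c‖ ^ 2 + ‖q + conj c‖ ^ 2) / ‖q‖ / 2 := by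
          rw [this]; simp only [S]; ring
        rw [hS]; ring
      rw [hz, max_self] at hmaj
      refine squeeze_zero' (Eventually.of_forall fun r => he0 r θ) ?_ hmaj
      filter_upwards [eventually_mem_Ioo_half_one] with r hr
      exact max_le_max_left _ (sub_le_sub_right (hYA hr θ) _)
    · -- in a gap the two kernels agree on the boundary and the integrand cancels
      have hqc : conj q = q := Complex.conj_eq_iff_im.mpr hcase
      have hAB : conj (dampedKernel δ (conj c) q) = dampedKernel δ c q := by
        simp [dampedKernel, damping, hqc]
      have hu := tendsto_circleMap_radius θ
      have hu1 : circleMap 0 1 θ ≠ 0 := circleMap_ne_center one_ne_zero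
      have hcu : conj (circleMap 0 1 θ) = (circleMap 0 1 θ)⁻¹ := by
        rw [inv_def, normSq_eq_norm_sq]; simp
      have hY : Tendsto (fun r => Y r θ) (𝓝[<] 1) (𝓝 0) := by
        have t1 : Tendsto (fun r => (h (circleMap 0 r θ) - conj (k (circleMap 0 r θ)))
            * A (circleMap 0 r θ) / circleMap 0 r θ) (𝓝[<] 1)
            (𝓝 (0 * dampedKernel δ c q / circleMap 0 1 θ)) := (hhk.mul hAq).div hu hu1
        have t2 : Tendsto (fun r => A (circleMap 0 r θ) / circleMap 0 r θ
            - conj (circleMap 0 r θ) * conj (B (circleMap 0 r θ))) (𝓝[<] 1) (𝓝 0) := by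
          have : Tendsto (fun r => A (circleMap 0 r θ) / circleMap 0 r θ
              - conj (circleMap 0 r θ) * conj (B (circleMap 0 r θ))) (𝓝[<] 1)
              (𝓝 (dampedKernel δ c q / circleMap 0 1 θ - conj (circleMap 0 1 θ)
                * conj (dampedKernel δ (conj c) q))) := (hAq.div hu hu1).sub (((continuous_conj.tendsto _).comp hu).mul
            ((continuous_conj.tendsto _).comp hBq))
          rw [hAB, hcu, div_eq_mul_inv, mul_comm _ (circleMap 0 1 θ)⁻¹, sub_self] at this
          exact this
        have t3 : Tendsto (fun r => conj (k (circleMap 0 r θ)) *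
            (A (circleMap 0 r θ) / circleMap 0 r θ
            - conj (circleMap 0 r θ) * conj (B (circleMap 0 r θ)))) (𝓝[<] 1) (𝓝 0) := by
          rw [tendsto_zero_iff_norm_tendsto_zero] at t2 ⊢
          refine squeeze_zero' (Eventually.of_forall fun r => norm_nonneg _) ?_ t2
          filter_upwards [eventually_mem_Ioo_half_one] with r hr
          rw [norm_mul, norm_conj]
          exact mul_le_of_le_one_left (norm_nonneg _) (hk1 _ (hmem hr θ))
        have t4 := t1.add t3
        rw [zero_mul, zero_div, add_zero] at t4
        refine t4.congr' ?_
        filter_upwards [eventually_mem_Ioo_half_one] with r hr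
        have hne : circleMap 0 r θ ≠ 0 := circleMap_ne_center (by linarith [hr.1])
        simp only [Y, V, hUu _ hne, map_mul]
        ring
      rw [tendsto_zero_iff_norm_tendsto_zero] at hY
      refine squeeze_zero' (Eventually.of_forall fun r => he0 r θ) ?_ hY
      filter_upwards [eventually_mem_Ioo_half_one] with r hr using heY hr θ
  have hint : Tendsto (fun r => ∫ θ in (0 : ℝ)..2 * Real.pi, e r θ) (𝓝[<] 1) (𝓝 0) := by
    have := intervalIntegral.tendsto_integral_filter_of_dominated_convergence (μ := volume)
      (a := 0) (b := 2 * Real.pi) (l := 𝓝[<] (1 : ℝ)) (F := e) (f := fun _ => (0 : ℝ))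
      (fun _ => 3 * K) ?_ ?_ (continuous_const.intervalIntegrable _ _) ?_
    · simpa using this
    · filter_upwards [eventually_mem_Ioo_half_one] with r hr
      exact (hec hr).aestronglyMeasurable
    · filter_upwards [eventually_mem_Ioo_half_one] with r hr
      refine Eventually.of_forall fun θ _ => ?_
      rw [Real.norm_of_nonneg (he0 r θ)]
      exact (heY hr θ).trans (hYK hr θ)
    · filter_upwards [hlim] with θ hθ _ using hθ
  have hfin : ∀ᶠ r in 𝓝[<] (1 : ℝ), 2 * Real.pi * (‖deriv h 0‖ * ‖A 0‖) ≤
      2 * (2 * Real.pi * (-2 * c.im)) + ∫ θ in (0 : ℝ)..2 * Real.pi, e r θ := by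
    filter_upwards [eventually_mem_Ioo_half_one] with r hr
    have hr0 : 0 < r := by linarith [hr.1]
    have h1 : 2 * Real.pi * (‖deriv h 0‖ * ‖A 0‖) = ‖∫ θ in (0 : ℝ)..2 * Real.pi, Y r θ‖ := by
      rw [hYint hr]
      simp [abs_of_pos Real.pi_pos]
    have cS := continuous_comp_circleMap hSc hr0 hr.2
    have h2 : ∫ θ in (0 : ℝ)..2 * Real.pi, ‖Y r θ‖ ≤
        ∫ θ in (0 : ℝ)..2 * Real.pi, (2 * S (p (circleMap 0 r θ)) + e r θ) :=
      intervalIntegral.integral_mono_on (by positivity)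
        ((hYc hr).norm.intervalIntegrable _ _)
        (((continuous_const.mul cS).add (hec hr)).intervalIntegrable _ _)
        (fun θ _ => hYe hr θ)
    have h3 := intervalIntegral.norm_integral_le_integral_norm (μ := volume) (f := Y r)
      (a := 0) (b := 2 * Real.pi) (by positivity)
    have h4 : ∫ θ in (0 : ℝ)..2 * Real.pi, (2 * S (p (circleMap 0 r θ)) + e r θ) =
        2 * (2 * Real.pi * (-2 * c.im)) + ∫ θ in (0 : ℝ)..2 * Real.pi, e r θ := by
      have c2 : Continuous fun θ => 2 * S (p (circleMap 0 r θ)) := continuous_const.mul cS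
      rw [intervalIntegral.integral_add (c2.intervalIntegrable _ _)
        ((hec hr).intervalIntegrable _ _), intervalIntegral.integral_const_mul, hSint hr]
    rw [h1, ← h4]
    exact h3.trans h2
  have := ge_of_tendsto (tendsto_const_nhds.add hint) hfin
  have hpi := Real.pi_pos
  have h5 : 2 * Real.pi * (‖deriv h 0‖ * ‖A 0‖) ≤ 2 * Real.pi * (-4 * c.im) := by linarith
  exact le_of_mul_le_mul_left h5 (by positivity)

/-- **The extremal estimate on the disc.** The functions `h` and `k` are bounded by one, and `p`
takes its values in the fourth quadrant; at almost every boundary point either `p` is purely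
imaginary, or `p` is real and `h` agrees with the conjugate of `k`. Then `h' 0` is at most
`|Im p 0| / |p 0|`. -/
theorem norm_mul_norm_deriv_le {p h k : ℂ → ℂ}
    (hp : DifferentiableOn ℂ p (ball 0 1)) (hre : ∀ u ∈ ball (0 : ℂ) 1, 0 < (p u).re)
    (him : ∀ u ∈ ball (0 : ℂ) 1, (p u).im < 0)
    (hh : DifferentiableOn ℂ h (ball 0 1)) (hh1 : ∀ u ∈ ball (0 : ℂ) 1, ‖h u‖ ≤ 1) (h0 : h 0 = 0)
    (hk : DifferentiableOn ℂ k (ball 0 1)) (hk1 : ∀ u ∈ ball (0 : ℂ) 1, ‖k u‖ ≤ 1)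
    (hbd : ∀ᵐ θ : ℝ, ∃ q : ℂ, Tendsto (fun r : ℝ => p (circleMap 0 r θ)) (𝓝[<] 1) (𝓝 q) ∧
      q ≠ 0 ∧ (q.re = 0 ∨ (q.im = 0 ∧
        Tendsto (fun r : ℝ => h (circleMap 0 r θ) - conj (k (circleMap 0 r θ)))
          (𝓝[<] 1) (𝓝 0)))) :
    ‖p 0‖ * ‖deriv h 0‖ ≤ -(p 0).im := by
  have m0 : (0 : ℂ) ∈ ball (0 : ℂ) 1 := by simp
  have hp0 : p 0 ≠ 0 := fun h => by simpa [h] using hre 0 m0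
  have hlim : Tendsto (fun δ : ℝ => ‖deriv h 0‖ * ‖dampedKernel δ (p 0) (p 0)‖) (𝓝[>] 0)
      (𝓝 (‖deriv h 0‖ * ‖dampedKernel 0 (p 0) (p 0)‖)) := by
    have : ContinuousAt (fun δ : ℝ => ‖deriv h 0‖ * ‖dampedKernel δ (p 0) (p 0)‖) 0 := by
      unfold dampedKernel damping
      have : (1 + ((0 : ℝ) : ℂ) * (p 0 + (p 0)⁻¹)) ≠ 0 := by simp
      fun_prop (disch := assumption)
    exact this.tendsto.mono_left nhdsWithin_le_nhds
  have hle := le_of_tendsto hlim (b := -4 * (p 0).im) (by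
    filter_upwards [self_mem_nhdsWithin] with δ hδ
    exact norm_deriv_mul_norm_dampedKernel_le hp hre him hh hh1 h0 hk hk1 hbd hδ)
  have h4 : dampedKernel 0 (p 0) (p 0) = 4 * p 0 := by
    rw [dampedKernel, damping, ofReal_zero, zero_mul, add_zero, inv_one, mul_one, div_eq_iff hp0]
    ring
  rw [h4, norm_mul] at hle
  simp only [Complex.norm_ofNat] at hle
  linarith

/-! ### Uniqueness and symmetry of the Ahlfors function -/

lemma norm_midpoint_add_norm_sq_lt_one {v w : ℂ} (hv : ‖v‖ < 1) (hw : ‖w‖ < 1) :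
    ‖(v + w) / 2‖ + ‖(v - w) / 2‖ ^ 2 / 2 < 1 := by
  have h1 : ‖(v + w) / 2‖ ^ 2 + ‖(v - w) / 2‖ ^ 2 = (‖v‖ ^ 2 + ‖w‖ ^ 2) / 2 := by
    rw [norm_div, norm_div, div_pow, div_pow]
    simp only [Complex.sq_norm, normSq_apply, add_re, add_im, sub_re, sub_im, Complex.norm_ofNat]
    ring
  have h2 : ‖v‖ ^ 2 < 1 := by nlinarith [norm_nonneg v]
  have h3 : ‖w‖ ^ 2 < 1 := by nlinarith [norm_nonneg w]
  nlinarith [sq_nonneg (‖(v + w) / 2‖ - 1)]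

/-- **Uniqueness of the Ahlfors function.** If `w₁` and `w₂` are both extremal, so is their mean
`k`, and `|k| + |d|² / 2 < 1` for their half difference `d`. If `d` had a zero of finite order `n`
at `z₀`, then adding a small multiple of `d² / (z - z₀) ^ (2 n - 1)` to `k` would give a competitor
with a larger derivative. -/
theorem IsAhlforsFunction.eqOn {Ω : Set ℂ} (hΩ : IsOpen Ω) (hconn : IsPreconnected Ω) {z₀ : ℂ}
    (hz₀ : z₀ ∈ Ω) {w₁ w₂ : ℂ → ℂ} (h₁ : IsAhlforsFunction Ω z₀ w₁)
    (h₂ : IsAhlforsFunction Ω z₀ w₂) : EqOn w₁ w₂ Ω := by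
  obtain ⟨⟨hd₁, hm₁, hv₁⟩, M, hM, hM₁⟩ := h₁
  obtain ⟨⟨hd₂, hm₂, hv₂⟩, M', hM', hM₂⟩ := h₂
  obtain rfl := hM.unique hM'
  have hn := hΩ.mem_nhds hz₀
  set d : ℂ → ℂ := fun z => (w₁ z - w₂ z) / 2 with hd
  set k : ℂ → ℂ := fun z => (w₁ z + w₂ z) / 2 with hk
  have hdd : DifferentiableOn ℂ d Ω := (hd₁.sub hd₂).div_const 2
  have hdk : DifferentiableOn ℂ k Ω := (hd₁.add hd₂).div_const 2
  have hda : AnalyticOnNhd ℂ d Ω := hdd.analyticOnNhd hΩ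
  have hd0 : d z₀ = 0 := by simp [hd, hv₁, hv₂]
  have hk0 : k z₀ = 0 := by simp [hk, hv₁, hv₂]
  have hk' : HasDerivAt k (M : ℂ) z₀ := by
    have e₁ := (hd₁.differentiableAt hn).hasDerivAt
    have e₂ := (hd₂.differentiableAt hn).hasDerivAt
    rw [hM₁] at e₁
    rw [hM₂] at e₂
    have := (e₁.add e₂).div_const 2
    rw [add_self_div_two] at this
    exact this
  have hkd : ∀ z ∈ Ω, ‖k z‖ + ‖d z‖ ^ 2 / 2 < 1 := fun z hz =>
    norm_midpoint_add_norm_sq_lt_one (by simpa using hm₁ hz) (by simpa using hm₂ hz)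
  by_cases hev : ∀ᶠ z in 𝓝 z₀, d z = 0
  · intro z hz
    have : d z = 0 := hda.eqOn_zero_of_preconnected_of_eventuallyEq_zero hconn hz₀ hev hz
    simpa [hd, sub_eq_zero] using this
  exfalso
  obtain ⟨n, g, hga, hg0, hg⟩ := (hda z₀ hz₀).exists_eventuallyEq_pow_smul_nonzero_iff.mpr hev
  have hn0 : n ≠ 0 := by
    rintro rfl
    have := hg.self_of_nhds
    simp only [pow_zero, one_smul] at this
    exact hg0 (this.symm.trans hd0)
  obtain ⟨m, rfl⟩ := Nat.exists_eq_succ_of_ne_zero hn0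
  let q : ℂ → ℂ := fun z => d z ^ 2 / (z - z₀) ^ (2 * m + 1)
  have hqloc : q =ᶠ[𝓝 z₀] fun z => (z - z₀) * g z ^ 2 := by
    filter_upwards [hg] with z hz
    by_cases hzz : z = z₀
    · simp [q, hzz]
    · have : z - z₀ ≠ 0 := sub_ne_zero.mpr hzz
      simp only [q, hz, smul_eq_mul]
      rw [div_eq_iff (pow_ne_zero _ this), Nat.succ_eq_add_one]
      ring
  have hq' : HasDerivAt q (g z₀ ^ 2) z₀ := by
    have h1 : HasDerivAt (fun z => (z - z₀) * g z ^ 2) (g z₀ ^ 2) z₀ := by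
      have := ((hasDerivAt_id z₀).sub_const z₀).mul
        (hga.differentiableAt.hasDerivAt.pow 2)
      simp only [id, sub_self, zero_mul, add_zero, one_mul, Pi.pow_apply] at this
      exact this
    exact h1.congr_of_eventuallyEq hqloc
  have hqd : DifferentiableOn ℂ q Ω := by
    intro z hz
    by_cases hzz : z = z₀
    · subst hzz
      exact hq'.differentiableAt.differentiableWithinAt
    · have : (z - z₀) ^ (2 * m + 1) ≠ 0 := pow_ne_zero _ (sub_ne_zero.mpr hzz)
      exact ((hdd z hz).pow 2).div (by fun_prop) this
  have hq0 : q z₀ = 0 := by simp [q]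
  have hsmall : ∀ᶠ z in 𝓝 z₀, ‖k z‖ < 1 / 2 ∧ ‖q z‖ < 1 := by
    have c1 : ContinuousAt (fun z => ‖k z‖) z₀ := hk'.continuousAt.norm
    have c2 : ContinuousAt (fun z => ‖q z‖) z₀ := hq'.continuousAt.norm
    refine (c1.eventually (gt_mem_nhds ?_)).and (c2.eventually (gt_mem_nhds ?_))
    · simp [hk0]
    · simp [hq0]
  obtain ⟨r, hr, hball⟩ := Metric.eventually_nhds_iff_ball.mp hsmall
  set ε : ℝ := min (1 / 2) (r ^ (2 * m + 1) / 2) with hε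
  have hε0 : 0 < ε := by positivity
  -- the rotation that makes the perturbation increase the derivative
  set s : ℂ := conj (g z₀ ^ 2) / ‖g z₀ ^ 2‖ with hs
  have hg2 : g z₀ ^ 2 ≠ 0 := pow_ne_zero _ hg0
  have hng : (‖g z₀ ^ 2‖ : ℂ) ≠ 0 := by simpa using hg0
  have hs1 : ‖s‖ = 1 := by
    rw [hs, norm_div, norm_conj, norm_real, norm_norm, div_self (norm_ne_zero_iff.mpr hg2)]
  have hsg : s * g z₀ ^ 2 = ‖g z₀ ^ 2‖ := by
    rw [hs, div_mul_eq_mul_div, div_eq_iff hng, mul_comm, mul_conj, normSq_eq_norm_sq]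
    push_cast
    ring
  have hadm : Admissible Ω z₀ (fun z => k z + ε * s * q z) := by
    refine ⟨hdk.add (hqd.const_mul _), fun z hz => ?_, by simp [hk0, hq0]⟩
    rw [mem_ball_zero_iff]
    have hle : ‖k z + ε * s * q z‖ ≤ ‖k z‖ + ε * ‖q z‖ := by
      refine (norm_add_le _ _).trans_eq ?_
      rw [norm_mul, norm_mul, hs1, norm_real, Real.norm_of_nonneg hε0.le, mul_one]
    refine hle.trans_lt ?_
    by_cases hzb : z ∈ ball z₀ r
    · obtain ⟨b1, b2⟩ := hball z hzb
      have : ε * ‖q z‖ ≤ 1 / 2 * 1 :=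
        mul_le_mul (min_le_left _ _) b2.le (norm_nonneg _) (by norm_num)
      linarith
    · have hrz : r ≤ ‖z - z₀‖ := by simpa [dist_eq_norm] using hzb
      have hpow : r ^ (2 * m + 1) ≤ ‖z - z₀‖ ^ (2 * m + 1) := by gcongr
      have hrp : 0 < r ^ (2 * m + 1) := by positivity
      have hq1 : ‖q z‖ ≤ ‖d z‖ ^ 2 / r ^ (2 * m + 1) := by
        simp only [q, norm_div, norm_pow]
        gcongr
      have : ε * ‖q z‖ ≤ r ^ (2 * m + 1) / 2 * (‖d z‖ ^ 2 / r ^ (2 * m + 1)) :=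
        mul_le_mul (min_le_right _ _) hq1 (norm_nonneg _) (by positivity)
      have h5 : r ^ (2 * m + 1) / 2 * (‖d z‖ ^ 2 / r ^ (2 * m + 1)) = ‖d z‖ ^ 2 / 2 := by
        field_simp
      linarith [hkd z hz]
  have hle : ‖deriv (fun z => k z + ε * s * q z) z₀‖ ≤ M := hM.1 ⟨_, hadm, rfl⟩
  have hder := (hk'.add (hq'.const_mul (ε * s : ℂ))).deriv
  have hder' : deriv (fun z => k z + ε * s * q z) z₀ = ((M + ε * ‖g z₀ ^ 2‖ : ℝ) : ℂ) := by
    refine hder.trans ?_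
    rw [mul_assoc, hsg]
    push_cast
    rfl
  rw [hder'] at hle
  have h6 := (re_le_norm _).trans hle
  rw [ofReal_re] at h6
  have : 0 < ε * ‖g z₀ ^ 2‖ := mul_pos hε0 (norm_pos_iff.mpr hg2)
  linarith

lemma Admissible.conj_conj {Ω : Set ℂ} (hΩ : IsOpen Ω) (hsymm : ∀ z ∈ Ω, conj z ∈ Ω) {z₀ : ℂ}
    {f : ℂ → ℂ} (hf : Admissible Ω z₀ f) :
    Admissible Ω (conj z₀) (fun z => conj (f (conj z))) := by
  obtain ⟨hd, hm, h0⟩ := hf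
  refine ⟨fun z hz => ?_, fun z hz => ?_, by simp [h0]⟩
  · have h1 := (hd _ (hsymm z hz)).differentiableAt (hΩ.mem_nhds (hsymm z hz))
    have := h1.conj_conj
    rw [Complex.conj_conj] at this
    exact this.differentiableWithinAt
  · have := hm (hsymm z hz)
    simpa using this

/-- On a domain symmetric about the real axis, reflection turns the Ahlfors function at `z₀` into
the one at `conj z₀`. -/
lemma IsAhlforsFunction.conj_conj {Ω : Set ℂ} (hΩ : IsOpen Ω) (hsymm : ∀ z ∈ Ω, conj z ∈ Ω)
    {z₀ : ℂ} {w : ℂ → ℂ} (hw : IsAhlforsFunction Ω z₀ w) :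
    IsAhlforsFunction Ω (conj z₀) (fun z => conj (w (conj z))) := by
  obtain ⟨ha, M, hM, hdw⟩ := hw
  have hder : ∀ f : ℂ → ℂ, ∀ z, deriv (fun z => conj (f (conj z))) z = conj (deriv f (conj z)) :=
    fun f z => congrFun deriv_conj_conj z
  refine ⟨ha.conj_conj hΩ hsymm, M, ?_, ?_⟩
  · convert hM using 1
    ext r
    constructor
    · rintro ⟨f, hf, rfl⟩
      have := hf.conj_conj hΩ hsymm
      rw [Complex.conj_conj] at this
      exact ⟨_, this, by rw [hder, norm_conj]⟩
    · rintro ⟨f, hf, rfl⟩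
      exact ⟨_, hf.conj_conj hΩ hsymm, by rw [hder, norm_conj, Complex.conj_conj]⟩
  · rw [hder, Complex.conj_conj, hdw, conj_ofReal]

/-! ### The domain, its bands and its gaps -/

/-- The gaps are nonempty, positive, and in increasing order. -/
structure OrderedGaps (a b : Fin g → ℝ) : Prop where
  pos : ∀ j, 0 < a j
  lt : ∀ j, a j < b j
  sep : ∀ j k, j < k → b j < a k

/-- The left end points of the bands: `0`, followed by the right end points of the gaps. -/
def bandLeft (b : Fin g → ℝ) : Fin (g + 1) → ℝ := Fin.cons 0 b

@[simp] lemma bandLeft_zero : bandLeft b 0 = 0 := rfl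

@[simp] lemma bandLeft_succ (j : Fin g) : bandLeft b j.succ = b j := rfl

namespace OrderedGaps

lemma le_bandLeft (h : OrderedGaps a b) {k : Fin g} {i : Fin (g + 1)} (hki : k.val < i.val) :
    b k ≤ bandLeft b i := by
  induction i using Fin.cases with
  | zero => simp at hki
  | succ j =>
    rw [bandLeft_succ]
    rcases (show k ≤ j from Fin.le_def.mpr (by simpa using Nat.lt_succ_iff.mp hki)).eq_or_lt with
      rfl | hlt
    · exact le_rfl
    · exact ((h.sep k j hlt).trans (h.lt j)).le

lemma bandLeft_lt (h : OrderedGaps a b) {i : Fin (g + 1)} {j : Fin g} (hij : i.val ≤ j.val) :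
    bandLeft b i < a j := by
  induction i using Fin.cases with
  | zero => exact h.pos j
  | succ k => exact h.sep k j (Fin.lt_def.mpr (by simpa using hij))

lemma bandLeft_castSucc_lt (h : OrderedGaps a b) (j : Fin g) : bandLeft b j.castSucc < a j :=
  h.bandLeft_lt le_rfl

lemma bandLeft_nonneg (h : OrderedGaps a b) (i : Fin (g + 1)) : 0 ≤ bandLeft b i := by
  induction i using Fin.cases with
  | zero => exact le_rfl
  | succ k => exact ((h.pos k).trans (h.lt k)).le

lemma le_left_end (h : OrderedGaps a b) {j k : Fin g} (hjk : j ≤ k) : a j ≤ a k := by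
  rcases hjk.eq_or_lt with rfl | hlt
  · exact le_rfl
  · exact ((h.lt j).trans (h.sep j k hlt)).le

end OrderedGaps

lemma mem_realSet {x : ℝ} : x ∈ realSet a b ↔ 0 ≤ x ∧ ∀ j, x ≤ a j ∨ b j ≤ x := by
  simp only [realSet, Set.mem_sdiff, mem_Ici, mem_iUnion, mem_Ioo, not_exists, not_and_or, not_lt]

lemma isClosed_realSet : IsClosed (realSet a b) :=
  isClosed_Ici.sdiff (isOpen_iUnion fun _ => isOpen_Ioo)

lemma isOpen_domain : IsOpen (domain a b) :=
  (Complex.isometry_ofReal.isClosedEmbedding.isClosedMap _ isClosed_realSet).isOpen_compl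

lemma ofReal_mem_domain {x : ℝ} : (x : ℂ) ∈ domain a b ↔ x ∉ realSet a b := by
  simp [domain, complexSet]

lemma mem_domain_of_im_ne_zero {z : ℂ} (hz : z.im ≠ 0) : z ∈ domain a b := by
  rintro ⟨x, _, rfl⟩
  simp at hz

lemma conj_mem_domain {z : ℂ} (hz : z ∈ domain a b) : conj z ∈ domain a b := by
  rintro ⟨x, hx, hxz⟩
  refine hz ⟨x, hx, ?_⟩
  have := congrArg conj hxz
  simpa using this

lemma ofReal_mem_closure_halfPlane (x : ℝ) :
    (x : ℂ) ∈ closure {z : ℂ | 0 < z.im} ∧ (x : ℂ) ∈ closure {z : ℂ | z.im < 0} := by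
  simp [Complex.closure_setOfPred_lt_im, Complex.closure_setOfPred_im_lt]

lemma isPreconnected_domain : IsPreconnected (domain a b) := by
  -- each open half-plane, together with the gaps, is connected; the two pieces share `-1`
  set s : Set ℂ := {z | 0 < z.im} ∪ {z | z.im = 0 ∧ z ∈ domain a b} with hs
  set t : Set ℂ := {z | z.im < 0} ∪ {z | z.im = 0 ∧ z ∈ domain a b} with ht
  have hreal : ∀ z : ℂ, z.im = 0 → z = (z.re : ℂ) := fun z hz => Complex.ext rfl (by simp [hz])
  have h1 : IsPreconnected s := by
    refine (convex_halfSpace_im_gt 0).isPreconnected.subset_closure subset_union_left ?_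
    rintro z (hz | hz)
    · exact subset_closure hz
    · rw [hreal z hz.1]; exact (ofReal_mem_closure_halfPlane _).1
  have h2 : IsPreconnected t := by
    refine (convex_halfSpace_im_lt 0).isPreconnected.subset_closure subset_union_left ?_
    rintro z (hz | hz)
    · exact subset_closure hz
    · rw [hreal z hz.1]; exact (ofReal_mem_closure_halfPlane _).2
  have hm : ((-1 : ℝ) : ℂ) ∈ domain a b := by
    rw [ofReal_mem_domain, mem_realSet]
    norm_num
  have hst : domain a b = s ∪ t := by
    ext z
    simp only [hs, ht, mem_union, mem_ofPred_eq]
    constructor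
    · intro hz
      rcases lt_trichotomy z.im 0 with h | h | h <;> tauto
    · rintro ((h | h) | (h | h))
      · exact mem_domain_of_im_ne_zero h.ne'
      · exact h.2
      · exact mem_domain_of_im_ne_zero h.ne
      · exact h.2
  rw [hst]
  exact h1.union ((-1 : ℝ) : ℂ) (Or.inr ⟨ofReal_im _, hm⟩) (Or.inr ⟨ofReal_im _, hm⟩) h2

/-! ### The real rational function with interlacing zeros and poles -/

/-- Minus the monic polynomial whose zeros are the left end points of the bands. -/
noncomputable def num (b : Fin g → ℝ) : ℝ[X] := -∏ i, (X - C (bandLeft b i))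

/-- The monic polynomial whose zeros are the right end points of the bounded bands. -/
noncomputable def den (a : Fin g → ℝ) : ℝ[X] := ∏ j, (X - C (a j))

lemma aeval_num {A : Type*} [CommRing A] [Algebra ℝ A] (z : A) :
    aeval z (num b) = -∏ i, (z - algebraMap ℝ A (bandLeft b i)) := by
  simp [num, map_prod]

lemma aeval_den {A : Type*} [CommRing A] [Algebra ℝ A] (z : A) :
    aeval z (den a) = ∏ j, (z - algebraMap ℝ A (a j)) := by
  simp [den, map_prod]

lemma eval_num (x : ℝ) : (num b).eval x = -∏ i, (x - bandLeft b i) := by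
  simpa using aeval_num (b := b) x

lemma eval_den (x : ℝ) : (den a).eval x = ∏ j, (x - a j) := by
  simpa using aeval_den (a := a) x

namespace OrderedGaps

lemma bandLeft_mem_realSet (h : OrderedGaps a b) (i : Fin (g + 1)) :
    bandLeft b i ∈ realSet a b := by
  refine mem_realSet.mpr ⟨h.bandLeft_nonneg i, fun k => ?_⟩
  rcases lt_or_ge k.val i.val with hk | hk
  · exact Or.inr (h.le_bandLeft hk)
  · exact Or.inl (h.bandLeft_lt hk).le

lemma left_end_mem_realSet (h : OrderedGaps a b) (j : Fin g) : a j ∈ realSet a b := by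
  refine mem_realSet.mpr ⟨(h.pos j).le, fun k => ?_⟩
  rcases lt_or_ge k j with hk | hk
  · exact Or.inr (h.sep k j hk).le
  · exact Or.inl (h.le_left_end hk)

/-- A real point of a gap lies outside all bands. -/
lemma outside_bands (h : OrderedGaps a b) {x : ℝ} (hx : x ∉ realSet a b) :
    x < bandLeft b (Fin.last g) ∧ ∀ j : Fin g, x < bandLeft b j.castSucc ∨ a j < x := by
  rw [mem_realSet] at hx
  rcases lt_or_ge x 0 with h0 | h0
  · exact ⟨h0.trans_le (h.bandLeft_nonneg _), fun j => Or.inl (h0.trans_le (h.bandLeft_nonneg _))⟩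
  · push Not at hx
    obtain ⟨k, hk⟩ := hx h0
    refine ⟨hk.2.trans_le (h.le_bandLeft (by simp)), fun j => ?_⟩
    rcases lt_or_ge k j with hkj | hkj
    · exact Or.inl (hk.2.trans_le (h.le_bandLeft (by simpa using Fin.lt_def.mp hkj)))
    · exact Or.inr ((h.le_left_end hkj).trans_lt hk.1)

lemma aeval_num_ne_zero (h : OrderedGaps a b) {z : ℂ} (hz : z ∈ domain a b) :
    aeval z (num b) ≠ 0 := by
  rw [aeval_num, neg_ne_zero, Finset.prod_ne_zero_iff]
  intro i _ h0
  exact hz ⟨_, h.bandLeft_mem_realSet i, (sub_eq_zero.mp h0).symm⟩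

lemma aeval_den_ne_zero (h : OrderedGaps a b) {z : ℂ} (hz : z ∈ domain a b) :
    aeval z (den a) ≠ 0 := by
  rw [aeval_den, Finset.prod_ne_zero_iff]
  intro i _ h0
  exact hz ⟨_, h.left_end_mem_realSet i, (sub_eq_zero.mp h0).symm⟩

/-- The zeros of `num` and `den` interlace, hence are distinct. -/
lemma num_ne_zero_or_den_ne_zero (h : OrderedGaps a b) (x : ℝ) :
    (num b).eval x ≠ 0 ∨ (den a).eval x ≠ 0 := by
  by_contra! hc
  rw [eval_num, eval_den, neg_eq_zero, Finset.prod_eq_zero_iff, Finset.prod_eq_zero_iff] at hc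
  obtain ⟨⟨i, _, hi⟩, j, _, hj⟩ := hc
  have hij : bandLeft b i = a j := by linarith
  rcases le_or_gt i.val j.val with hle | hlt
  · exact (h.bandLeft_lt hle).ne hij
  · exact absurd (h.le_bandLeft hlt) (not_le.mpr (hij ▸ h.lt j))

lemma num_mul_den_nonpos (h : OrderedGaps a b) {x : ℝ} (hx : x ∈ realSet a b) :
    (num b).eval x * (den a).eval x ≤ 0 := by
  rw [mem_realSet] at hx
  rw [eval_num, eval_den, Fin.prod_univ_succ]
  simp only [bandLeft_zero, bandLeft_succ, sub_zero]
  have : 0 ≤ ∏ j, ((x - b j) * (x - a j)) := by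
    refine Finset.prod_nonneg fun j _ => ?_
    have := (h.lt j)
    rcases hx.2 j with h1 | h1
    · exact mul_nonneg_of_nonpos_of_nonpos (by linarith) (by linarith)
    · exact mul_nonneg (by linarith) (by linarith)
  rw [Finset.prod_mul_distrib] at this
  nlinarith [mul_nonneg hx.1 this]

lemma num_mul_den_pos (h : OrderedGaps a b) {x : ℝ} (hx : x ∉ realSet a b) :
    0 < (num b).eval x * (den a).eval x := by
  obtain ⟨h1, h2⟩ := h.outside_bands hx
  rw [eval_num, eval_den, Fin.prod_univ_castSucc]
  have : 0 < ∏ j : Fin g, ((x - bandLeft b j.castSucc) * (x - a j)) := by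
    refine Finset.prod_pos fun j _ => ?_
    have := h.bandLeft_castSucc_lt j
    rcases h2 j with h3 | h3
    · exact mul_pos_of_neg_of_neg (by linarith) (by linarith)
    · exact mul_pos (by linarith) (by linarith)
  rw [Finset.prod_mul_distrib] at this
  nlinarith [mul_pos (sub_pos.mpr h1) this]

end OrderedGaps

lemma derivative_num_eval {x : ℝ} (hx : (num b).eval x ≠ 0) :
    (derivative (num b)).eval x = (num b).eval x * ∑ i, (x - bandLeft b i)⁻¹ := by
  rw [eval_num, neg_ne_zero, Finset.prod_ne_zero_iff] at hx
  rw [eval_num, num, derivative_neg, derivative_prod_finset, eval_neg, eval_finsetSum, neg_mul,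
    Finset.mul_sum]
  congr 1
  refine Finset.sum_congr rfl fun i hi => ?_
  rw [← Finset.mul_prod_erase _ _ hi]
  have := hx i hi
  simp [eval_prod]
  field_simp

lemma derivative_den_eval {x : ℝ} (hx : (den a).eval x ≠ 0) :
    (derivative (den a)).eval x = (den a).eval x * ∑ i, (x - a i)⁻¹ := by
  rw [eval_den, Finset.prod_ne_zero_iff] at hx
  rw [eval_den, den, derivative_prod_finset, eval_finsetSum, Finset.mul_sum]
  refine Finset.sum_congr rfl fun i hi => ?_
  rw [← Finset.mul_prod_erase _ _ hi]
  have := hx i hi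
  simp [eval_prod]
  field_simp

/-- The Wronskian of `num` and `den`, the numerator of the derivative of `num / den`. -/
noncomputable def wronskianEval (a b : Fin g → ℝ) (x : ℝ) : ℝ :=
  (derivative (num b)).eval x * (den a).eval x - (num b).eval x * (derivative (den a)).eval x

/-- The function `num / den` is strictly decreasing between its zeros and poles. The logarithmic
derivative is a sum over the zeros minus a sum over the poles; on a band each pole is paired with
the zero at the other end of its gap, and on a gap with the zero at the other end of its band. -/
lemma OrderedGaps.wronskianEval_neg (h : OrderedGaps a b) {x : ℝ} (hN : (num b).eval x ≠ 0)
    (hD : (den a).eval x ≠ 0) : wronskianEval a b x < 0 := by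
  have hN' := hN
  have hD' := hD
  rw [eval_num, neg_ne_zero, Finset.prod_ne_zero_iff] at hN'
  rw [eval_den, Finset.prod_ne_zero_iff] at hD'
  have hw : wronskianEval a b x = ((num b).eval x * (den a).eval x) *
      (∑ i, (x - bandLeft b i)⁻¹ - ∑ j, (x - a j)⁻¹) := by
    rw [wronskianEval, derivative_num_eval hN, derivative_den_eval hD]
    ring
  rw [hw]
  by_cases hx : x ∈ realSet a b
  · have h1 : (num b).eval x * (den a).eval x < 0 :=
      lt_of_le_of_ne (h.num_mul_den_nonpos hx) (mul_ne_zero hN hD)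
    refine mul_neg_of_neg_of_pos h1 ?_
    rw [Fin.sum_univ_succ]
    rw [mem_realSet] at hx
    have hx0 : 0 < x := lt_of_le_of_ne hx.1 (by simpa [eq_comm] using hN' 0 (Finset.mem_univ _))
    have h2 : ∑ j, (x - a j)⁻¹ ≤ ∑ j : Fin g, (x - bandLeft b j.succ)⁻¹ := by
      refine Finset.sum_le_sum fun j _ => ?_
      have e1 := hD' j (Finset.mem_univ _)
      have e2 := hN' j.succ (Finset.mem_univ _)
      rw [bandLeft_succ] at e2 ⊢
      have e3 := h.lt j
      rcases hx.2 j with h3 | h3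
      · have : x - a j < 0 := lt_of_le_of_ne (by linarith) e1
        exact (inv_le_inv_of_neg (by linarith) (by linarith)).mpr (by linarith)
      · have : 0 < x - b j := lt_of_le_of_ne (by linarith) e2.symm
        exact inv_anti₀ this (by linarith)
    have h3 : 0 < (x - bandLeft b 0)⁻¹ := by simpa using hx0
    linarith
  · refine mul_neg_of_pos_of_neg (h.num_mul_den_pos hx) ?_
    obtain ⟨h1, h2⟩ := h.outside_bands hx
    rw [Fin.sum_univ_castSucc]
    have h3 : ∑ j : Fin g, (x - bandLeft b j.castSucc)⁻¹ ≤ ∑ j, (x - a j)⁻¹ := by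
      refine Finset.sum_le_sum fun j _ => ?_
      have e3 := h.bandLeft_castSucc_lt j
      rcases h2 j with h4 | h4
      · exact (inv_le_inv_of_neg (by linarith) (by linarith)).mpr (by linarith)
      · exact inv_anti₀ (by linarith) (by linarith)
    have h4 : (x - bandLeft b (Fin.last g))⁻¹ < 0 := inv_lt_zero.mpr (by linarith)
    linarith

/-! ### The quotient maps the upper half-plane to the lower one -/

/-- The rational function `num / den` on the complex plane. -/
noncomputable def quot (a b : Fin g → ℝ) (z : ℂ) : ℂ := aeval z (num b) / aeval z (den a)

lemma aeval_conj_real (p : ℝ[X]) (z : ℂ) : aeval (conj z) p = conj (aeval z p) := by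
  have := aeval_algHom_apply (Complex.conjAe : ℂ →ₐ[ℝ] ℂ) z p
  simpa using this

lemma aeval_ofReal_eq (p : ℝ[X]) (x : ℝ) : aeval (x : ℂ) p = ((p.eval x : ℝ) : ℂ) := by
  have := aeval_algebraMap_apply ℂ x p
  simpa using this

lemma quot_conj (z : ℂ) : quot a b (conj z) = conj (quot a b z) := by
  simp only [quot, aeval_conj_real, map_div₀]

lemma arg_sub_lt_arg_sub {z : ℂ} (hz : 0 < z.im) {c d : ℝ} (hcd : c < d) :
    arg (z - c) < arg (z - d) := by
  have hc : 0 < (z - c).im := by simpa using hz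
  have hd : 0 < (z - d).im := by simpa using hz
  have hc0 : z - c ≠ 0 := fun h => by simp [h] at hc
  have hd0 : z - d ≠ 0 := fun h => by simp [h] at hd
  by_contra! hle
  have h1 : 0 ≤ arg (z - d) := arg_nonneg_iff.mpr hd.le
  have h2 := arg_le_pi (z - c)
  have h3 : 0 ≤ Real.sin (arg (z - c) - arg (z - d)) :=
    Real.sin_nonneg_of_nonneg_of_le_pi (by linarith) (by linarith)
  rw [Real.sin_sub, sin_arg, sin_arg, cos_arg hc0, cos_arg hd0] at h3
  have nc := norm_pos_iff.mpr hc0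
  have nd := norm_pos_iff.mpr hd0
  have h4 : (z - c).im / ‖z - c‖ * ((z - d).re / ‖z - d‖)
      - (z - c).re / ‖z - c‖ * ((z - d).im / ‖z - d‖) =
      z.im * (c - d) / (‖z - c‖ * ‖z - d‖) := by
    simp only [sub_re, sub_im, ofReal_re, ofReal_im]
    field_simp
    ring
  rw [h4, le_div_iff₀ (by positivity)] at h3
  nlinarith

/-- The argument of `-num / den` is a sum of angles, at most the whole angle `π`, subtended at `z`
by disjoint intervals. -/
lemma OrderedGaps.quot_im_neg (h : OrderedGaps a b) {z : ℂ} (hz : 0 < z.im) :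
    (quot a b z).im < 0 := by
  have hc : ∀ c : ℝ, 0 < (z - c).im := fun c => by simpa using hz
  have hc0 : ∀ c : ℝ, z - c ≠ 0 := fun c h => by have := hc c; simp [h] at this
  set s : ℂ := ∑ i, log (z - bandLeft b i) - ∑ j, log (z - a j) with hs
  have hq : quot a b z = -exp s := by
    rw [quot, aeval_num, aeval_den, hs, exp_sub, exp_sum, exp_sum, neg_div]
    simp only [exp_log (hc0 _), coe_algebraMap]
  have him : s.im = ∑ i, arg (z - bandLeft b i) - ∑ j, arg (z - a j) := by
    simp [hs, log_im]
  have hpos : 0 < s.im := by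
    rw [him, Fin.sum_univ_succ]
    have h1 : ∑ j, arg (z - a j) ≤ ∑ j : Fin g, arg (z - bandLeft b j.succ) :=
      Finset.sum_le_sum fun j _ => (arg_sub_lt_arg_sub hz (h.lt j)).le
    have h2 : 0 < arg (z - bandLeft b 0) :=
      lt_of_le_of_ne (arg_nonneg_iff.mpr (hc _).le) (fun h0 => by
        have := (arg_eq_zero_iff.mp h0.symm).2
        exact (hc _).ne' this)
    linarith
  have hpi : s.im < Real.pi := by
    rw [him, Fin.sum_univ_castSucc]
    have h1 : ∑ j : Fin g, arg (z - bandLeft b j.castSucc) ≤ ∑ j, arg (z - a j) :=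
      Finset.sum_le_sum fun j _ => (arg_sub_lt_arg_sub hz (h.bandLeft_castSucc_lt j)).le
    have h2 : arg (z - bandLeft b (Fin.last g)) < Real.pi := arg_lt_pi_iff.mpr (Or.inr (hc _).ne')
    linarith
  rw [hq, neg_im, exp_im, neg_lt_zero]
  exact mul_pos (Real.exp_pos _) (Real.sin_pos_of_pos_of_lt_pi hpos hpi)

lemma OrderedGaps.quot_im_pos (h : OrderedGaps a b) {z : ℂ} (hz : z.im < 0) :
    0 < (quot a b z).im := by
  have := h.quot_im_neg (z := conj z) (by simpa using hz)
  rw [quot_conj] at this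
  simpa using this

lemma quot_ofReal (x : ℝ) : quot a b x = (((num b).eval x / (den a).eval x : ℝ) : ℂ) := by
  rw [quot, aeval_ofReal_eq, aeval_ofReal_eq, ofReal_div]

lemma OrderedGaps.quot_mem_slitPlane (h : OrderedGaps a b) {z : ℂ} (hz : z ∈ domain a b) :
    quot a b z ∈ slitPlane := by
  rw [mem_slitPlane_iff]
  rcases lt_trichotomy z.im 0 with h0 | h0 | h0
  · exact Or.inr (h.quot_im_pos h0).ne'
  · have hzr : z = (z.re : ℂ) := Complex.ext rfl (by simp [h0])
    rw [hzr, ofReal_mem_domain] at hz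
    left
    rw [hzr, quot_ofReal, ofReal_re]
    exact div_pos_iff.mpr (mul_pos_iff.mp (h.num_mul_den_pos hz))
  · exact Or.inr (h.quot_im_neg h0).ne

lemma OrderedGaps.differentiableOn_quot (h : OrderedGaps a b) :
    DifferentiableOn ℂ (quot a b) (domain a b) :=
  DifferentiableOn.div (Polynomial.differentiable_aeval _).differentiableOn
    (Polynomial.differentiable_aeval _).differentiableOn fun _ hz => h.aeval_den_ne_zero hz

/-! ### The square root of the quotient -/

/-- The square root of `num / den` with positive real part, on the domain. -/
noncomputable def root (a b : Fin g → ℝ) (z : ℂ) : ℂ := exp (log (quot a b z) / 2)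

namespace OrderedGaps

lemma root_sq (h : OrderedGaps a b) {z : ℂ} (hz : z ∈ domain a b) :
    root a b z ^ 2 = quot a b z := by
  rw [root, ← exp_nat_mul]
  push_cast
  rw [mul_div_cancel₀ _ two_ne_zero, exp_log (slitPlane_ne_zero (h.quot_mem_slitPlane hz))]

lemma root_re_pos (h : OrderedGaps a b) {z : ℂ} (hz : z ∈ domain a b) :
    0 < (root a b z).re := by
  have h1 := (mem_slitPlane_iff_arg.mp (h.quot_mem_slitPlane hz)).1
  have h2 := arg_le_pi (quot a b z)
  have h3 := neg_pi_lt_arg (quot a b z)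
  have h4 : arg (quot a b z) < Real.pi := lt_of_le_of_ne h2 h1
  rw [root, exp_re]
  have h5 : (log (quot a b z) / 2).im = arg (quot a b z) / 2 := by
    rw [show (2 : ℂ) = ((2 : ℝ) : ℂ) by norm_num, div_ofReal_im, log_im]
  rw [h5]
  exact mul_pos (Real.exp_pos _) (Real.cos_pos_of_mem_Ioo ⟨by linarith, by linarith⟩)

lemma root_ne_zero (h : OrderedGaps a b) {z : ℂ} (hz : z ∈ domain a b) : root a b z ≠ 0 :=
  fun h0 => by simpa [h0] using h.root_re_pos hz

lemma root_conj (h : OrderedGaps a b) {z : ℂ} (hz : z ∈ domain a b) :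
    root a b (conj z) = conj (root a b z) := by
  rw [root, quot_conj, log_conj _ (mem_slitPlane_iff_arg.mp (h.quot_mem_slitPlane hz)).1, root,
    ← exp_conj, map_div₀, map_ofNat]

lemma root_im_neg (h : OrderedGaps a b) {z : ℂ} (hz : 0 < z.im) : (root a b z).im < 0 := by
  have hzd : z ∈ domain a b := mem_domain_of_im_ne_zero hz.ne'
  have h1 := h.quot_im_neg hz
  rw [← h.root_sq hzd, pow_two, mul_im] at h1
  have := h.root_re_pos hzd
  by_contra! hc
  nlinarith

lemma differentiableOn_root (h : OrderedGaps a b) :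
    DifferentiableOn ℂ (root a b) (domain a b) :=
  ((h.differentiableOn_quot.clog fun _ hz => h.quot_mem_slitPlane hz).div_const 2).cexp

lemma continuousAt_root (h : OrderedGaps a b) {z : ℂ} (hz : z ∈ domain a b) :
    ContinuousAt (root a b) z :=
  (h.differentiableOn_root.differentiableAt (isOpen_domain.mem_nhds hz)).continuousAt

end OrderedGaps

/-! ### The extremal estimate on the domain -/

/-- The Möbius map of the unit disc onto the upper half-plane, sending `0` to `z₀`. -/
noncomputable def halfPlaneMap (z₀ u : ℂ) : ℂ := (z₀ - conj z₀ * u) / (1 - u)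

lemma halfPlaneMap_im {z₀ u : ℂ} :
    (halfPlaneMap z₀ u).im = z₀.im * (1 - normSq u) / normSq (1 - u) := by
  rw [halfPlaneMap, div_im, ← sub_div]
  congr 1
  simp [normSq_apply]
  ring

lemma hasDerivAt_halfPlaneMap (z₀ : ℂ) {u : ℂ} (hu : u ≠ 1) :
    HasDerivAt (halfPlaneMap z₀) ((z₀ - conj z₀) / (1 - u) ^ 2) u := by
  have h1 : 1 - u ≠ 0 := sub_ne_zero.mpr hu.symm
  have := (((hasDerivAt_id u).const_mul (conj z₀)).const_sub z₀).div
    ((hasDerivAt_id u).const_sub 1) h1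
  refine (this.congr_deriv ?_ : HasDerivAt (halfPlaneMap z₀) _ u)
  simp only [id]
  ring

lemma ne_one_of_mem_ball {u : ℂ} (hu : u ∈ ball (0 : ℂ) 1) : u ≠ 1 := by
  rintro rfl
  simp at hu

lemma halfPlaneMap_im_pos {z₀ u : ℂ} (hz₀ : 0 < z₀.im) (hu : u ∈ ball (0 : ℂ) 1) :
    0 < (halfPlaneMap z₀ u).im := by
  rw [halfPlaneMap_im]
  have h1 : 0 < normSq (1 - u) := normSq_pos.mpr (sub_ne_zero.mpr (ne_one_of_mem_ball hu).symm)
  have h2 : ‖u‖ < 1 := by simpa using hu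
  have h3 : normSq u < 1 := by rw [normSq_eq_norm_sq]; nlinarith [norm_nonneg u]
  exact div_pos (mul_pos hz₀ (by linarith)) h1

/-- The largest possible derivative at `z₀`: an upper bound by `OrderedGaps.norm_deriv_le`, attained
by `ExtremalData.deriv_extremal`. -/
noncomputable def extremalValue (a b : Fin g → ℝ) (z₀ : ℂ) : ℝ :=
  -(root a b z₀).im / (2 * ‖root a b z₀‖ * z₀.im)

/-- Boundary values of the square root on the bands, approached from the upper half-plane. -/
lemma OrderedGaps.tendsto_root_of_mem_band (h : OrderedGaps a b) {ι : Type*} {l : Filter ι}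
    {v : ι → ℂ} {x : ℝ} (hx : x ∈ realSet a b) (hN : (num b).eval x ≠ 0)
    (hD : (den a).eval x ≠ 0) (hv : Tendsto v l (𝓝 (x : ℂ))) (him : ∀ᶠ i in l, 0 < (v i).im) :
    Tendsto (fun i => root a b (v i)) l
      (𝓝 (-(Real.sqrt (-((num b).eval x / (den a).eval x)) * I))) := by
  set t := (num b).eval x / (den a).eval x with ht
  have htneg : t < 0 :=
    div_neg_iff.mpr (mul_neg_iff.mp (lt_of_le_of_ne (h.num_mul_den_nonpos hx) (mul_ne_zero hN hD)))
  set s := Real.sqrt (-t) with hs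
  have hs0 : 0 < s := Real.sqrt_pos.mpr (by linarith)
  have hs2 : s ^ 2 = -t := Real.sq_sqrt (by linarith)
  have hDx : aeval (x : ℂ) (den a) ≠ 0 := by
    rw [aeval_ofReal_eq]; exact_mod_cast hD
  have hq : Tendsto (fun i => quot a b (v i)) l (𝓝 (t : ℂ)) := by
    have : ContinuousAt (quot a b) (x : ℂ) := by
      unfold quot
      exact (Polynomial.continuous_aeval _).continuousAt.div
        (Polynomial.continuous_aeval _).continuousAt hDx
    have := this.tendsto.comp hv
    rwa [quot_ofReal] at this
  rw [tendsto_iff_norm_sub_tendsto_zero] at hq ⊢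
  have hq' : Tendsto (fun i => ‖quot a b (v i) - t‖ / s) l (𝓝 0) := by
    simpa using hq.div_const s
  refine squeeze_zero' (Eventually.of_forall fun _ => norm_nonneg _) ?_ hq'
  filter_upwards [him] with i hi
  -- `root² + s² = (root + i s) (root - i s)`, and the second factor is at least `s`
  rw [le_div_iff₀ hs0, ← h.root_sq (mem_domain_of_im_ne_zero hi.ne'), sub_neg_eq_add]
  have h1 : root a b (v i) ^ 2 - t = (root a b (v i) + s * I) * (root a b (v i) - s * I) := by
    have : (t : ℂ) = -(s : ℂ) ^ 2 := by rw [← ofReal_pow, hs2]; push_cast; ring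
    rw [this]
    ring_nf
    rw [I_sq]
    ring
  rw [h1, norm_mul]
  refine mul_le_mul_of_nonneg_left ?_ (norm_nonneg _)
  have h2 := abs_im_le_norm (root a b (v i) - s * I)
  have h3 := h.root_im_neg hi
  have h4 : (root a b (v i) - s * I).im = (root a b (v i)).im - s := by simp
  rw [h4] at h2
  linarith [neg_le_abs ((root a b (v i)).im - s)]

/-- The extremal estimate: the upper half-plane is mapped to the disc, `p` is the transplanted square
root, and `k` carries the values of the competitor on the lower half-plane, reflected. -/
theorem OrderedGaps.norm_deriv_le (h : OrderedGaps a b) {z₀ : ℂ} (hz₀ : 0 < z₀.im) {f : ℂ → ℂ}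
    (hf : Admissible (domain a b) z₀ f) : ‖deriv f z₀‖ ≤ extremalValue a b z₀ := by
  obtain ⟨hfd, hfm, hf0⟩ := hf
  have hzd : z₀ ∈ domain a b := mem_domain_of_im_ne_zero hz₀.ne'
  set T := halfPlaneMap z₀ with hT
  have hT0 : T 0 = z₀ := by simp [hT, halfPlaneMap]
  have hTd : DifferentiableOn ℂ T (ball 0 1) := fun u hu =>
    (hasDerivAt_halfPlaneMap z₀ (ne_one_of_mem_ball hu)).differentiableAt.differentiableWithinAt
  have hTim : ∀ u ∈ ball (0 : ℂ) 1, 0 < (T u).im := fun u hu => halfPlaneMap_im_pos hz₀ hu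
  have hTm : MapsTo T (ball 0 1) (domain a b) := fun u hu =>
    mem_domain_of_im_ne_zero (hTim u hu).ne'
  have hcd : DifferentiableOn ℂ (fun z => conj (f (conj z))) (domain a b) := fun z hz => by
    have := (hfd.differentiableAt (isOpen_domain.mem_nhds (conj_mem_domain hz))).conj_conj
    rw [Complex.conj_conj] at this
    exact this.differentiableWithinAt
  have hlt : ∀ z ∈ domain a b, ‖f z‖ ≤ 1 := fun z hz => by
    have := hfm hz
    rw [mem_ball_zero_iff] at this
    exact this.le
  have key := norm_mul_norm_deriv_le (p := fun u => root a b (T u)) (h := fun u => f (T u))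
    (k := fun u => conj (f (conj (T u)))) (h.differentiableOn_root.comp hTd hTm)
    (fun u hu => h.root_re_pos (hTm hu)) (fun u hu => h.root_im_neg (hTim u hu))
    (hfd.comp hTd hTm) (fun u hu => hlt _ (hTm hu)) (by simp only [hT0, hf0])
    (hcd.comp hTd hTm) (fun u hu => by
      rw [norm_conj]; exact hlt _ (conj_mem_domain (hTm hu))) ?_
  · have hder : deriv (fun u => f (T u)) 0 = deriv f z₀ * (z₀ - conj z₀) := by
      have h1 : HasDerivAt T ((z₀ - conj z₀) / (1 - 0) ^ 2) 0 :=
        hasDerivAt_halfPlaneMap z₀ zero_ne_one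
      have h2 : HasDerivAt f (deriv f z₀) (T 0) := by
        rw [hT0]
        exact (hfd.differentiableAt (isOpen_domain.mem_nhds hzd)).hasDerivAt
      have := (h2.comp 0 h1).deriv
      simpa [Function.comp_def] using this
    have hn : ‖z₀ - conj z₀‖ = 2 * z₀.im := by
      rw [sub_conj, norm_mul, norm_I, mul_one, norm_real, Real.norm_of_nonneg (by linarith)]
    simp only [hT0] at key
    rw [hder, norm_mul, hn] at key
    have hpos : 0 < ‖root a b z₀‖ := norm_pos_iff.mpr (h.root_ne_zero hzd)
    rw [extremalValue, le_div_iff₀ (by positivity)]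
    linarith
  · -- boundary behaviour, away from the finitely many points over the end points and `∞`
    let S : Set ℂ := {1} ∪ ((fun x : ℝ => ((x : ℂ) - z₀) / (x - conj z₀)) ''
      {x | (num b).eval x = 0 ∨ (den a).eval x = 0})
    have hS : S.Countable := by
      refine (countable_singleton _).union (Countable.image ?_ _)
      have : {x | (num b).eval x = 0 ∨ (den a).eval x = 0} ⊆
          range (bandLeft b) ∪ range a := by
        rintro x (hx | hx)
        · rw [eval_num, neg_eq_zero, Finset.prod_eq_zero_iff] at hx
          obtain ⟨i, _, hi⟩ := hx
          exact Or.inl ⟨i, by linarith⟩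
        · rw [eval_den, Finset.prod_eq_zero_iff] at hx
          obtain ⟨i, _, hi⟩ := hx
          exact Or.inr ⟨i, by linarith⟩
      exact ((countable_range _).union (countable_range _)).mono this
    have hae : ∀ᵐ θ : ℝ, circleMap 0 1 θ ∉ S :=
      (hS.preimage_circleMap 0 one_ne_zero).ae_notMem volume
    filter_upwards [hae] with θ hθ
    set u := circleMap 0 1 θ with hu
    have hu1 : u ≠ 1 := fun h1 => hθ (Or.inl h1)
    have hnu : normSq u = 1 := by rw [normSq_eq_norm_sq]; simp [hu]
    set x : ℝ := (T u).re with hxdef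
    have hTx : T u = (x : ℂ) := by
      refine Complex.ext rfl ?_
      rw [hT, halfPlaneMap_im, hnu]
      simp
    have hx : (num b).eval x ≠ 0 ∧ (den a).eval x ≠ 0 := by
      rw [← not_or]
      intro hx
      refine hθ (Or.inr ⟨x, hx, ?_⟩)
      have h1 : (x : ℂ) - conj z₀ ≠ 0 := fun h1 => by
        have := congrArg Complex.im h1
        simp at this
        exact hz₀.ne' this
      have h2 : 1 - u ≠ 0 := sub_ne_zero.mpr hu1.symm
      simp only
      rw [div_eq_iff h1, ← hTx, hT, halfPlaneMap]
      field_simp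
      ring
    have hrad : Tendsto (fun r : ℝ => T (circleMap 0 r θ)) (𝓝[<] 1) (𝓝 (x : ℂ)) := by
      rw [← hTx]
      exact ((hasDerivAt_halfPlaneMap z₀ hu1).continuousAt.tendsto).comp
        (tendsto_circleMap_radius θ)
    have hradim : ∀ᶠ r : ℝ in 𝓝[<] 1, 0 < (T (circleMap 0 r θ)).im := by
      filter_upwards [eventually_mem_Ioo_half_one] with r hr
      refine hTim _ ?_
      have : 0 < r := by linarith [hr.1]
      simpa [abs_of_pos this] using hr.2
    by_cases hxE : x ∈ realSet a b
    · refine ⟨_, h.tendsto_root_of_mem_band hxE hx.1 hx.2 hrad hradim, ?_, Or.inl (by simp)⟩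
      have : (num b).eval x / (den a).eval x < 0 := div_neg_iff.mpr (mul_neg_iff.mp
        (lt_of_le_of_ne (h.num_mul_den_nonpos hxE) (mul_ne_zero hx.1 hx.2)))
      have h3 := (Real.sqrt_pos.mpr (by linarith : 0 < -((num b).eval x / (den a).eval x))).ne'
      exact neg_ne_zero.mpr (mul_ne_zero (by exact_mod_cast h3) I_ne_zero)
    · have hxd : (x : ℂ) ∈ domain a b := ofReal_mem_domain.mpr hxE
      refine ⟨root a b x, (h.continuousAt_root hxd).tendsto.comp hrad, h.root_ne_zero hxd,
        Or.inr ⟨?_, ?_⟩⟩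
      · rw [← Complex.conj_eq_iff_im, ← h.root_conj hxd, conj_ofReal]
      · have hc : ContinuousAt f (x : ℂ) :=
          (hfd.differentiableAt (isOpen_domain.mem_nhds hxd)).continuousAt
        have h1 := hc.tendsto.comp hrad
        have h2 : Tendsto (fun r : ℝ => conj (T (circleMap 0 r θ))) (𝓝[<] 1) (𝓝 (x : ℂ)) := by
          have := (continuous_conj.tendsto (x : ℂ)).comp hrad
          rwa [conj_ofReal] at this
        have h3 := h1.sub (hc.tendsto.comp h2)
        rw [sub_self] at h3
        refine h3.congr fun r => ?_
        simp

/-! ### The explicit extremal function -/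

lemma exists_fin_map_eq {α : Type*} {n : ℕ} {s : Multiset α} (hs : s.card = n) :
    ∃ ρ : Fin n → α, Finset.univ.val.map ρ = s := by
  induction s using Quotient.inductionOn with
  | h l =>
    obtain rfl : l.length = n := hs
    exact ⟨l.get, by rw [Fin.univ_val_map, List.ofFn_get]; rfl⟩

/-- The zeros of `num - conj (quot z₀) * den` other than `conj z₀` all lie in the lower half-plane.
They are the zeros of the extremal function besides `z₀`. -/
lemma OrderedGaps.exists_zeros (h : OrderedGaps a b) {z₀ : ℂ} (hz₀ : 0 < z₀.im) :
    ∃ ρ : Fin g → ℂ, (∀ k, (ρ k).im < 0) ∧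
      (num b).map (algebraMap ℝ ℂ) - C (conj (quot a b z₀)) * (den a).map (algebraMap ℝ ℂ) =
        -((X - C (conj z₀)) * ∏ k, (X - C (ρ k))) := by
  set c := conj (quot a b z₀) with hc
  have hcim : 0 < c.im := by
    have := h.quot_im_neg hz₀
    simpa [hc] using this
  set A : ℂ[X] := ∏ i, (X - C (bandLeft b i : ℂ)) with hA
  set B : ℂ[X] := ∏ j, (X - C (a j : ℂ)) with hB
  have hnum : (num b).map (algebraMap ℝ ℂ) = -A := by
    simp [num, hA, Polynomial.map_prod]
  have hden : (den a).map (algebraMap ℝ ℂ) = B := by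
    simp [den, hB, Polynomial.map_prod]
  have hAm : A.Monic := monic_prod_X_sub_C _ _
  have hBm : B.Monic := monic_prod_X_sub_C _ _
  have hAd : A.natDegree = g + 1 := by simp [hA, natDegree_finsetProd_X_sub_C_eq_card]
  have hBd : B.natDegree = g := by simp [hB, natDegree_finsetProd_X_sub_C_eq_card]
  have hdeg : (C c * B).degree < A.degree := by
    rw [degree_C_mul (fun h0 => by simp [h0] at hcim), degree_eq_natDegree hAm.ne_zero, degree_eq_natDegree hBm.ne_zero, hAd, hBd]
    exact_mod_cast Nat.lt_succ_self g
  have hPm : (A + C c * B).Monic := hAm.add_of_left hdeg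
  have hPd : (A + C c * B).natDegree = g + 1 := by
    rw [natDegree_add_eq_left_of_degree_lt hdeg, hAd]
  have heval : ∀ z, (A + C c * B).eval z = -(aeval z (num b) - c * aeval z (den a)) := by
    intro z
    rw [← eval_map_algebraMap, ← eval_map_algebraMap, hnum, hden]
    simp
    ring
  have hroot : ∀ z, (A + C c * B).eval z = 0 → aeval z (den a) ≠ 0 ∧ quot a b z = c := by
    intro z hz
    rw [heval, neg_eq_zero, sub_eq_zero] at hz
    have hd : aeval z (den a) ≠ 0 := by
      intro hd
      rw [hd, mul_zero] at hz
      by_cases him : z.im = 0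
      · have hzr : z = (z.re : ℂ) := Complex.ext rfl (by simp [him])
        rw [hzr, aeval_ofReal_eq] at hz hd
        rcases h.num_ne_zero_or_den_ne_zero z.re with h1 | h1
        · exact h1 (by exact_mod_cast hz)
        · exact h1 (by exact_mod_cast hd)
      · exact h.aeval_den_ne_zero (mem_domain_of_im_ne_zero him) hd
    exact ⟨hd, by rw [quot, hz, mul_div_cancel_right₀ _ hd]⟩
  have hlow : ∀ z, (A + C c * B).eval z = 0 → z.im < 0 := by
    intro z hz
    have hq := (hroot z hz).2
    rcases lt_trichotomy z.im 0 with h0 | h0 | h0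
    · exact h0
    · have hzr : z = (z.re : ℂ) := Complex.ext rfl (by simp [h0])
      rw [hzr, quot_ofReal] at hq
      rw [← hq, ofReal_im] at hcim
      exact absurd hcim (lt_irrefl _)
    · have := h.quot_im_neg h0
      rw [hq] at this
      linarith
  have hz0d : conj z₀ ∈ domain a b := mem_domain_of_im_ne_zero (by simpa using hz₀.ne')
  have hz0 : (A + C c * B).IsRoot (conj z₀) := by
    rw [IsRoot.def, heval, hc, ← quot_conj, quot, div_mul_cancel₀ _ (h.aeval_den_ne_zero hz0d),
      sub_self, neg_zero]
  obtain ⟨Q, hQ⟩ := dvd_iff_isRoot.mpr hz0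
  have hQm : Q.Monic := (monic_X_sub_C (conj z₀)).of_mul_monic_left (hQ ▸ hPm)
  have hQd : Q.natDegree = g := by
    have := congrArg natDegree hQ
    rw [hPd, (monic_X_sub_C (conj z₀)).natDegree_mul hQm, natDegree_X_sub_C] at this
    omega
  have hQs : Q.Splits := IsAlgClosed.splits Q
  obtain ⟨ρ, hρ⟩ := exists_fin_map_eq (hQs.natDegree_eq_card_roots.symm.trans hQd)
  have hQρ : Q = ∏ k, (X - C (ρ k)) := by
    conv_lhs => rw [hQs.eq_prod_roots_of_monic hQm, ← hρ, Multiset.map_map]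
    rfl
  refine ⟨ρ, fun k => hlow _ ?_, ?_⟩
  · rw [hQ, hQρ, eval_mul, eval_prod, Finset.prod_eq_zero (Finset.mem_univ k) (by simp), mul_zero]
  · rw [← hQρ, ← hQ, hnum, hden]
    ring

/-- The data of the explicit extremal function: the point `z₀` in the upper half-plane and the other
zeros `ρ k`, in the lower half-plane. -/
structure ExtremalData (a b : Fin g → ℝ) (z₀ : ℂ) (ρ : Fin g → ℂ) : Prop where
  gaps : OrderedGaps a b
  im_pos : 0 < z₀.im
  im_neg : ∀ k, (ρ k).im < 0
  factor : (num b).map (algebraMap ℝ ℂ)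
      - C (conj (quot a b z₀)) * (den a).map (algebraMap ℝ ℂ) =
    -((X - C (conj z₀)) * ∏ k, (X - C (ρ k)))

/-- The extremal function `-σ (z - z₀) / (z - conj z₀) * (f - conj f₀) / (f + f₀)`, where `f` is the
square root of `num / den`, `f₀ = f z₀` and `σ = f₀ / |f₀|`, with the common zero of its numerator
and denominator at `conj z₀` cancelled. -/
noncomputable def extremal (a b : Fin g → ℝ) (z₀ : ℂ) (ρ : Fin g → ℂ) (z : ℂ) : ℂ :=
  root a b z₀ / ‖root a b z₀‖ * ((z - z₀) * ∏ k, (z - ρ k)) /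
    (aeval z (den a) * ((root a b z + root a b z₀) * (root a b z + conj (root a b z₀))))

lemma norm_sub_le_norm_sub_conj {z w : ℂ} (h : 0 ≤ z.im * w.im) : ‖z - w‖ ≤ ‖z - conj w‖ := by
  rw [norm_def, norm_def]
  apply Real.sqrt_le_sqrt
  simp only [normSq_apply, sub_re, sub_im, conj_re, conj_im]
  nlinarith

lemma norm_sub_conj_lt_norm_add {p q : ℂ} (hp : 0 < p.re) (hq : 0 < q.re) :
    ‖p - conj q‖ < ‖p + q‖ := by
  rw [norm_def, norm_def]
  apply Real.sqrt_lt_sqrt (normSq_nonneg _)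
  simp only [normSq_apply, sub_re, sub_im, add_re, add_im, conj_re, conj_im]
  nlinarith [mul_pos hp hq]

namespace ExtremalData

variable {z₀ : ℂ} {ρ : Fin g → ℂ}

lemma mem_domain (h : ExtremalData a b z₀ ρ) : z₀ ∈ domain a b :=
  mem_domain_of_im_ne_zero h.im_pos.ne'

lemma aeval_factor (h : ExtremalData a b z₀ ρ) (z : ℂ) :
    (z - conj z₀) * ∏ k, (z - ρ k) =
      -(aeval z (num b) - conj (quot a b z₀) * aeval z (den a)) := by
  have := congrArg (eval z) h.factor
  simp only [eval_sub, eval_mul, eval_C, eval_map_algebraMap, eval_neg, eval_X, eval_prod] at this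
  rw [this, neg_neg]

lemma aeval_factor_conj (h : ExtremalData a b z₀ ρ) (z : ℂ) :
    (z - z₀) * ∏ k, (z - conj (ρ k)) =
      -(aeval z (num b) - quot a b z₀ * aeval z (den a)) := by
  have := congrArg conj (h.aeval_factor (conj z))
  simp only [aeval_conj_real] at this
  simpa using this

lemma factor_eq (h : ExtremalData a b z₀ ρ) {z : ℂ} (hz : z ∈ domain a b) :
    (z - conj z₀) * ∏ k, (z - ρ k) = -(aeval z (den a) *
      ((root a b z - conj (root a b z₀)) * (root a b z + conj (root a b z₀)))) := by
  have hD := h.gaps.aeval_den_ne_zero hz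
  have h1 : aeval z (num b) = root a b z ^ 2 * aeval z (den a) := by
    rw [h.gaps.root_sq hz, quot, div_mul_cancel₀ _ hD]
  rw [h.aeval_factor, h1, ← h.gaps.root_sq h.mem_domain, map_pow]
  ring

lemma factor_conj_eq (h : ExtremalData a b z₀ ρ) {z : ℂ} (hz : z ∈ domain a b) :
    (z - z₀) * ∏ k, (z - conj (ρ k)) = -(aeval z (den a) *
      ((root a b z - root a b z₀) * (root a b z + root a b z₀))) := by
  have hD := h.gaps.aeval_den_ne_zero hz
  have h1 : aeval z (num b) = root a b z ^ 2 * aeval z (den a) := by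
    rw [h.gaps.root_sq hz, quot, div_mul_cancel₀ _ hD]
  rw [h.aeval_factor_conj, h1, ← h.gaps.root_sq h.mem_domain]
  ring

lemma root_add_ne_zero (h : ExtremalData a b z₀ ρ) {z : ℂ} (hz : z ∈ domain a b) :
    root a b z + root a b z₀ ≠ 0 := fun h0 => by
  have h1 := congrArg Complex.re h0
  have h2 := h.gaps.root_re_pos hz
  have h3 := h.gaps.root_re_pos h.mem_domain
  simp at h1
  linarith

lemma root_add_conj_ne_zero (h : ExtremalData a b z₀ ρ) {z : ℂ} (hz : z ∈ domain a b) :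
    root a b z + conj (root a b z₀) ≠ 0 := fun h0 => by
  have h1 := congrArg Complex.re h0
  have h2 := h.gaps.root_re_pos hz
  have h3 := h.gaps.root_re_pos h.mem_domain
  simp at h1
  linarith

lemma norm_unimodular (h : ExtremalData a b z₀ ρ) :
    ‖root a b z₀ / ‖root a b z₀‖‖ = 1 := by
  rw [norm_div, norm_real, norm_norm, div_self]
  exact norm_ne_zero_iff.mpr (h.gaps.root_ne_zero h.mem_domain)

/-- The form of the extremal function that shows it to be bounded by one on the closed upper
half-plane. -/
lemma extremal_mul_upper (h : ExtremalData a b z₀ ρ) {z : ℂ} (hz : z ∈ domain a b) :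
    extremal a b z₀ ρ z * ((z - conj z₀) * (root a b z + root a b z₀)) =
      -(root a b z₀ / ‖root a b z₀‖) * ((z - z₀) * (root a b z - conj (root a b z₀))) := by
  have hD := h.gaps.aeval_den_ne_zero hz
  have h1 := h.root_add_ne_zero hz
  have h2 := h.root_add_conj_ne_zero hz
  have h3 := h.factor_eq hz
  rw [extremal, div_mul_eq_mul_div, div_eq_iff (mul_ne_zero hD (mul_ne_zero h1 h2))]
  linear_combination (root a b z₀ / ‖root a b z₀‖) * (z - z₀) * (root a b z + root a b z₀) * h3

/-- The form of the extremal function that shows it to be bounded by one on the lower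
half-plane. -/
lemma extremal_mul_lower (h : ExtremalData a b z₀ ρ) {z : ℂ} (hz : z ∈ domain a b) :
    extremal a b z₀ ρ z * ((∏ k, (z - conj (ρ k))) * (root a b z + conj (root a b z₀))) =
      -(root a b z₀ / ‖root a b z₀‖) * ((∏ k, (z - ρ k)) * (root a b z - root a b z₀)) := by
  have hD := h.gaps.aeval_den_ne_zero hz
  have h1 := h.root_add_ne_zero hz
  have h2 := h.root_add_conj_ne_zero hz
  have h3 := h.factor_conj_eq hz
  rw [extremal, div_mul_eq_mul_div, div_eq_iff (mul_ne_zero hD (mul_ne_zero h1 h2))]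
  linear_combination (root a b z₀ / ‖root a b z₀‖) * (∏ k, (z - ρ k)) *
    (root a b z + conj (root a b z₀)) * h3

lemma norm_extremal_lt_one (h : ExtremalData a b z₀ ρ) {z : ℂ} (hz : z ∈ domain a b) :
    ‖extremal a b z₀ ρ z‖ < 1 := by
  have hr := h.gaps.root_re_pos hz
  have hr₀ := h.gaps.root_re_pos h.mem_domain
  by_contra! hc
  rcases le_or_gt 0 z.im with h0 | h0
  · have h1 := congrArg norm (h.extremal_mul_upper hz)
    rw [norm_mul, norm_mul, norm_mul, norm_neg, h.norm_unimodular, one_mul, norm_mul] at h1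
    have h2 := norm_sub_le_norm_sub_conj (z := z) (w := z₀) (mul_nonneg h0 h.im_pos.le)
    have h3 := norm_sub_conj_lt_norm_add hr hr₀
    have h4 : 0 < ‖z - conj z₀‖ := norm_pos_iff.mpr fun h4 => by
      have := congrArg Complex.im h4
      simp at this
      linarith [h.im_pos]
    have h5 : ‖z - z₀‖ * ‖root a b z - conj (root a b z₀)‖ <
        ‖z - conj z₀‖ * ‖root a b z + root a b z₀‖ :=
      mul_lt_mul' h2 h3 (norm_nonneg _) h4
    nlinarith [le_mul_of_one_le_left
      (mul_nonneg h4.le (norm_nonneg (root a b z + root a b z₀))) hc]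
  · have h1 := congrArg norm (h.extremal_mul_lower hz)
    rw [norm_mul, norm_mul, norm_mul, norm_neg, h.norm_unimodular, one_mul, norm_mul,
      norm_prod, norm_prod] at h1
    have h2 : ∏ k, ‖z - ρ k‖ ≤ ∏ k, ‖z - conj (ρ k)‖ :=
      Finset.prod_le_prod (fun _ _ => norm_nonneg _) fun k _ =>
        norm_sub_le_norm_sub_conj (mul_nonneg_of_nonpos_of_nonpos h0.le (h.im_neg k).le)
    have h3 : ‖root a b z - root a b z₀‖ < ‖root a b z + conj (root a b z₀)‖ := by
      have := norm_sub_conj_lt_norm_add hr (q := conj (root a b z₀)) (by simpa using hr₀)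
      rwa [Complex.conj_conj] at this
    have h4 : 0 < ∏ k, ‖z - conj (ρ k)‖ := Finset.prod_pos fun k _ => norm_pos_iff.mpr fun h4 => by
      have := congrArg Complex.im h4
      simp at this
      linarith [h.im_neg k]
    have h5 : (∏ k, ‖z - ρ k‖) * ‖root a b z - root a b z₀‖ <
        (∏ k, ‖z - conj (ρ k)‖) * ‖root a b z + conj (root a b z₀)‖ :=
      mul_lt_mul' h2 h3 (norm_nonneg _) h4
    nlinarith [le_mul_of_one_le_left
      (mul_nonneg h4.le (norm_nonneg (root a b z + conj (root a b z₀)))) hc]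

lemma differentiableOn_extremal (h : ExtremalData a b z₀ ρ) :
    DifferentiableOn ℂ (extremal a b z₀ ρ) (domain a b) := by
  have hr := h.gaps.differentiableOn_root
  have hp : Differentiable ℂ fun z => ∏ k, (z - ρ k) := by fun_prop
  have hD : Differentiable ℂ fun z : ℂ => aeval z (den a) := Polynomial.differentiable_aeval _
  refine DifferentiableOn.div ?_ ?_ fun z hz => mul_ne_zero (h.gaps.aeval_den_ne_zero hz)
    (mul_ne_zero (h.root_add_ne_zero hz) (h.root_add_conj_ne_zero hz))
  · exact (((differentiable_id.sub_const z₀).mul hp).const_mul _).differentiableOn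
  · exact hD.differentiableOn.mul ((hr.add_const _).mul (hr.add_const _))

lemma admissible_extremal (h : ExtremalData a b z₀ ρ) :
    Admissible (domain a b) z₀ (extremal a b z₀ ρ) :=
  ⟨h.differentiableOn_extremal,
    fun _ hz => mem_ball_zero_iff.mpr (h.norm_extremal_lt_one hz), by simp [extremal]⟩

lemma deriv_extremal (h : ExtremalData a b z₀ ρ) :
    deriv (extremal a b z₀ ρ) z₀ = (extremalValue a b z₀ : ℂ) := by
  have hw := (h.differentiableOn_extremal.differentiableAt
    (isOpen_domain.mem_nhds h.mem_domain)).hasDerivAt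
  have hr := (h.gaps.differentiableOn_root.differentiableAt
    (isOpen_domain.mem_nhds h.mem_domain)).hasDerivAt
  have hid : ∀ c : ℂ, HasDerivAt (fun z : ℂ => z - c) 1 z₀ := fun c =>
    (hasDerivAt_id z₀).sub_const c
  -- differentiate the relation `extremal_mul_upper` at `z₀`, where no quotient appears
  have h1 := hw.mul ((hid (conj z₀)).mul (hr.add_const (root a b z₀)))
  have h2 := ((hid z₀).mul (hr.sub_const (conj (root a b z₀)))).const_mul
    (-(root a b z₀ / ‖root a b z₀‖))
  have heq := h1.unique (h2.congr_of_eventuallyEq (by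
    filter_upwards [isOpen_domain.mem_nhds h.mem_domain] with z hz
    exact h.extremal_mul_upper hz))
  have hw0 : extremal a b z₀ ρ z₀ = 0 := by simp [extremal]
  have h0 := h.gaps.root_ne_zero h.mem_domain
  have h0n : (‖root a b z₀‖ : ℂ) ≠ 0 := by simpa using h0
  have him : (z₀.im : ℂ) ≠ 0 := by exact_mod_cast h.im_pos.ne'
  simp only [Pi.mul_apply, hw0, sub_self, zero_mul, add_zero, one_mul, sub_conj] at heq
  rw [extremalValue]
  push_cast
  rw [eq_div_iff (by simp [h0, him])]
  field_simp at heq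
  push_cast at heq
  linear_combination heq / 2

/-- The explicit function solves the Ahlfors problem. -/
lemma isAhlforsFunction_extremal (h : ExtremalData a b z₀ ρ) :
    IsAhlforsFunction (domain a b) z₀ (extremal a b z₀ ρ) := by
  refine ⟨h.admissible_extremal, extremalValue a b z₀, ⟨?_, fun M hM => ?_⟩, h.deriv_extremal⟩
  · rintro r ⟨f, hf, rfl⟩
    exact h.gaps.norm_deriv_le h.im_pos hf
  · have := hM ⟨_, h.admissible_extremal, rfl⟩
    rw [h.deriv_extremal, norm_real] at this
    exact (le_abs_self _).trans this

lemma ahlforsFunction_eqOn (h : ExtremalData a b z₀ ρ) :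
    EqOn (ahlforsFunction (domain a b) z₀) (extremal a b z₀ ρ) (domain a b) :=
  (Classical.epsilon_spec ⟨_, h.isAhlforsFunction_extremal⟩ :
    IsAhlforsFunction (domain a b) z₀ (ahlforsFunction (domain a b) z₀)).eqOn isOpen_domain
    isPreconnected_domain h.mem_domain h.isAhlforsFunction_extremal

lemma ahlforsFunction_conj_eqOn (h : ExtremalData a b z₀ ρ) :
    EqOn (ahlforsFunction (domain a b) (conj z₀)) (fun z => conj (extremal a b z₀ ρ (conj z)))
      (domain a b) := by
  have hc := h.isAhlforsFunction_extremal.conj_conj isOpen_domain fun _ hz => conj_mem_domain hz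
  exact (Classical.epsilon_spec ⟨_, hc⟩ : IsAhlforsFunction (domain a b) (conj z₀)
    (ahlforsFunction (domain a b) (conj z₀))).eqOn isOpen_domain isPreconnected_domain
    (conj_mem_domain h.mem_domain) hc

end ExtremalData

/-! ### The discriminant as a rational function -/

/-- The denominator `(num - c * den) * (num - conj c * den)` of the discriminant, where
`c = (x + i y)²`. -/
noncomputable def discDen (a b : Fin g → ℝ) (x y : ℝ) : ℝ[X] :=
  num b ^ 2 - C (2 * (x ^ 2 - y ^ 2)) * (num b * den a) + C ((x ^ 2 + y ^ 2) ^ 2) * den a ^ 2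

/-- The numerator of the discriminant. -/
noncomputable def discNum (a b : Fin g → ℝ) (x y : ℝ) : ℝ[X] :=
  2 * discDen a b x y + C (16 * x ^ 2) * (num b * den a)

/-- The discriminant as a rational function; in terms of `F = num / den` it is
`2 + 16 x² F / ((F - c) (F - conj c))`. -/
noncomputable def discRat (a b : Fin g → ℝ) (x y : ℝ) : RatFunc ℝ :=
  algebraMap ℝ[X] (RatFunc ℝ) (discNum a b x y) / algebraMap ℝ[X] (RatFunc ℝ) (discDen a b x y)

lemma aeval_discDen {A : Type*} [CommRing A] [Algebra ℝ A] (x y : ℝ) (z : A) :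
    aeval z (discDen a b x y) = aeval z (num b) ^ 2
      - algebraMap ℝ A (2 * (x ^ 2 - y ^ 2)) * (aeval z (num b) * aeval z (den a))
      + algebraMap ℝ A ((x ^ 2 + y ^ 2) ^ 2) * aeval z (den a) ^ 2 := by
  simp only [discDen, map_add, map_sub, map_mul, map_pow, aeval_C]

lemma aeval_discNum {A : Type*} [CommRing A] [Algebra ℝ A] (x y : ℝ) (z : A) :
    aeval z (discNum a b x y) = 2 * aeval z (discDen a b x y)
      + algebraMap ℝ A (16 * x ^ 2) * (aeval z (num b) * aeval z (den a)) := by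
  simp only [discNum, map_add, map_mul, map_pow, aeval_C, map_ofNat]

lemma OrderedGaps.isCoprime_num_den (h : OrderedGaps a b) : IsCoprime (num b) (den a) := by
  rw [num, IsCoprime.neg_left_iff, den]
  refine IsCoprime.prod_left fun i _ => IsCoprime.prod_right fun j _ => ?_
  refine isCoprime_X_sub_C_of_isUnit_sub (IsUnit.mk0 _ fun h0 => ?_)
  rcases h.num_ne_zero_or_den_ne_zero (a j) with h1 | h1
  · rw [eval_num, neg_ne_zero, Finset.prod_ne_zero_iff] at h1
    exact h1 i (Finset.mem_univ _) (by linarith)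
  · rw [eval_den, Finset.prod_ne_zero_iff] at h1
    exact h1 j (Finset.mem_univ _) (by linarith)

lemma OrderedGaps.isCoprime_disc (h : OrderedGaps a b) {x y : ℝ} (hx : 0 < x) :
    IsCoprime (discNum a b x y) (discDen a b x y) := by
  have h1 := h.isCoprime_num_den
  have hm : IsUnit (C ((x ^ 2 + y ^ 2) ^ 2) : ℝ[X]) :=
    isUnit_C.mpr (IsUnit.mk0 _ (by positivity))
  have eN : discDen a b x y = C ((x ^ 2 + y ^ 2) ^ 2) * den a ^ 2
      + num b * (num b - C (2 * (x ^ 2 - y ^ 2)) * den a) := by rw [discDen]; ring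
  have eD : discDen a b x y = num b ^ 2
      + den a * (C ((x ^ 2 + y ^ 2) ^ 2) * den a - C (2 * (x ^ 2 - y ^ 2)) * num b) := by
    rw [discDen]; ring
  have hN : IsCoprime (num b) (discDen a b x y) := by
    have h2 : IsCoprime (num b) (C ((x ^ 2 + y ^ 2) ^ 2) * den a ^ 2) :=
      (isCoprime_mul_unit_left_right hm _ _).mpr h1.pow_right
    rw [eN]
    exact h2.add_mul_left_right _
  have hD : IsCoprime (den a) (discDen a b x y) := by
    have h2 : IsCoprime (den a) (num b ^ 2) := h1.symm.pow_right
    rw [eD]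
    exact h2.add_mul_left_right _
  have hc : IsUnit (C (16 * x ^ 2) : ℝ[X]) := isUnit_C.mpr (IsUnit.mk0 _ (by positivity))
  have h3 : IsCoprime (C (16 * x ^ 2) * (num b * den a)) (discDen a b x y) :=
    (isCoprime_mul_unit_left_left hc _ _).mpr (hN.mul_left hD)
  rw [discNum, add_comm]
  exact h3.add_mul_right_left 2

namespace ExtremalData

variable {z₀ : ℂ} {ρ : Fin g → ℂ}

lemma quot_eq (h : ExtremalData a b z₀ ρ) :
    quot a b z₀ = ((root a b z₀).re + (root a b z₀).im * I) ^ 2 := by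
  rw [re_add_im, h.gaps.root_sq h.mem_domain]

lemma aeval_discDen_eq (h : ExtremalData a b z₀ ρ) (z : ℂ) :
    aeval z (discDen a b (root a b z₀).re (root a b z₀).im) =
      (aeval z (num b) - quot a b z₀ * aeval z (den a)) *
        (aeval z (num b) - conj (quot a b z₀) * aeval z (den a)) := by
  rw [aeval_discDen, h.quot_eq]
  simp only [coe_algebraMap, map_pow, map_add, map_mul, conj_ofReal, conj_I]
  push_cast
  ring_nf
  simp only [I_sq, show I ^ 4 = 1 from I_pow_four]
  ring

lemma map_discDen (h : ExtremalData a b z₀ ρ) :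
    (discDen a b (root a b z₀).re (root a b z₀).im).map (algebraMap ℝ ℂ) =
      ((X - C z₀) * ∏ k, (X - C (conj (ρ k)))) * ((X - C (conj z₀)) * ∏ k, (X - C (ρ k))) := by
  refine Polynomial.funext fun z => ?_
  rw [eval_map_algebraMap, h.aeval_discDen_eq]
  simp only [eval_mul, eval_sub, eval_X, eval_C, eval_prod]
  rw [h.aeval_factor, h.aeval_factor_conj]
  ring

lemma discDen_monic (h : ExtremalData a b z₀ ρ) :
    (discDen a b (root a b z₀).re (root a b z₀).im).Monic := by
  rw [← Polynomial.monic_map_iff (f := algebraMap ℝ ℂ), h.map_discDen]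
  exact ((monic_X_sub_C _).mul (monic_prod_X_sub_C _ _)).mul
    ((monic_X_sub_C _).mul (monic_prod_X_sub_C _ _))

lemma aroots_discDen (h : ExtremalData a b z₀ ρ) :
    (discDen a b (root a b z₀).re (root a b z₀).im).aroots ℂ =
      {z₀, conj z₀} + Finset.univ.val.map (fun k => conj (ρ k)) + Finset.univ.val.map ρ := by
  have e1 : (∏ k, (X - C (conj (ρ k)))).roots = Finset.univ.val.map (fun k => conj (ρ k)) := by
    have := roots_multiset_prod_X_sub_C (Finset.univ.val.map (fun k => conj (ρ k)))
    rwa [Multiset.map_map] at this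
  have e2 : (∏ k, (X - C (ρ k))).roots = Finset.univ.val.map ρ := by
    have := roots_multiset_prod_X_sub_C (Finset.univ.val.map ρ)
    rwa [Multiset.map_map] at this
  have m1 := monic_prod_X_sub_C (fun k => conj (ρ k)) Finset.univ
  have m2 := monic_prod_X_sub_C ρ Finset.univ
  have m3 := (monic_X_sub_C z₀).mul m1
  have m4 := (monic_X_sub_C (conj z₀)).mul m2
  rw [aroots, h.map_discDen, roots_mul (m3.mul m4).ne_zero, roots_mul m3.ne_zero,
    roots_mul m4.ne_zero, e1, e2, roots_X_sub_C, roots_X_sub_C]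
  rw [show ({z₀, conj z₀} : Multiset ℂ) = {z₀} + {conj z₀} from rfl]
  abel

lemma discRat_denom (h : ExtremalData a b z₀ ρ) :
    (discRat a b (root a b z₀).re (root a b z₀).im).denom =
      discDen a b (root a b z₀).re (root a b z₀).im := by
  have hW := h.discDen_monic
  have hc := h.gaps.isCoprime_disc (y := (root a b z₀).im) (h.gaps.root_re_pos h.mem_domain)
  have h1 := (RatFunc.num_mul_eq_mul_denom_iff hW.ne_zero).mpr
    (rfl : discRat a b (root a b z₀).re (root a b z₀).im = _)
  refine eq_of_monic_of_associated (RatFunc.monic_denom _) hW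
    (associated_of_dvd_dvd (RatFunc.denom_div_dvd _ _) ?_)
  exact hc.symm.dvd_of_dvd_mul_left (Dvd.intro_left _ h1)

lemma discRat_num (h : ExtremalData a b z₀ ρ) :
    (discRat a b (root a b z₀).re (root a b z₀).im).num =
      discNum a b (root a b z₀).re (root a b z₀).im := by
  have hW := h.discDen_monic
  have h1 := (RatFunc.num_mul_eq_mul_denom_iff hW.ne_zero).mpr
    (rfl : discRat a b (root a b z₀).re (root a b z₀).im = _)
  rw [h.discRat_denom] at h1
  exact mul_right_cancel₀ hW.ne_zero h1

lemma value_discRat (h : ExtremalData a b z₀ ρ) (z : ℂ) :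
    value (discRat a b (root a b z₀).re (root a b z₀).im) z =
      aeval z (discNum a b (root a b z₀).re (root a b z₀).im) /
        aeval z (discDen a b (root a b z₀).re (root a b z₀).im) := by
  rw [value, RatFunc.eval, h.discRat_denom, h.discRat_num, aeval_def, aeval_def]

lemma isPole_discRat (h : ExtremalData a b z₀ ρ) (z : ℂ) :
    IsPole (discRat a b (root a b z₀).re (root a b z₀).im) z ↔
      aeval z (discDen a b (root a b z₀).re (root a b z₀).im) = 0 := by
  rw [IsPole, h.discRat_denom]

/-- The product of the two Ahlfors functions in terms of the square root `f`. -/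
lemma ahlforsProduct_mul (h : ExtremalData a b z₀ ρ) {z : ℂ} (hz : z ∈ domain a b) :
    ahlforsProduct a b z₀ z *
        ((root a b z + root a b z₀) * (root a b z + conj (root a b z₀))) =
      (root a b z - root a b z₀) * (root a b z - conj (root a b z₀)) := by
  rw [ahlforsProduct, h.ahlforsFunction_eqOn hz, h.ahlforsFunction_conj_eqOn hz]
  beta_reduce
  have hw0 : extremal a b z₀ ρ z₀ = 0 := by simp [extremal]
  by_cases h1 : z = z₀
  · subst h1
    simp [hw0]
  by_cases h2 : z = conj z₀
  · subst h2
    simp [hw0, h.gaps.root_conj h.mem_domain]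
  have e1 := h.extremal_mul_upper hz
  have e2 := congrArg conj (h.extremal_mul_upper (conj_mem_domain hz))
  rw [h.gaps.root_conj hz] at e2
  simp only [map_mul, map_sub, map_add, map_neg, map_div₀, Complex.conj_conj, conj_ofReal] at e2
  have hs : root a b z₀ / ‖root a b z₀‖ * (conj (root a b z₀) / ‖root a b z₀‖) = 1 := by
    have h0 : (‖root a b z₀‖ : ℂ) ≠ 0 := by simpa using h.gaps.root_ne_zero h.mem_domain
    rw [div_mul_div_comm, mul_conj, normSq_eq_norm_sq]
    push_cast
    field_simp
  refine mul_left_cancel₀ (mul_ne_zero (sub_ne_zero.mpr h1) (sub_ne_zero.mpr h2)) ?_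
  have e3 := congrArg₂ (· * ·) e1 e2
  linear_combination e3 + (z - z₀) * (z - conj z₀) * (root a b z - root a b z₀) *
    (root a b z - conj (root a b z₀)) * hs

lemma aeval_discDen_root (h : ExtremalData a b z₀ ρ) {z : ℂ} (hz : z ∈ domain a b) :
    aeval z (discDen a b (root a b z₀).re (root a b z₀).im) =
      aeval z (den a) ^ 2 *
        ((root a b z - root a b z₀) * (root a b z - conj (root a b z₀))) *
        ((root a b z + root a b z₀) * (root a b z + conj (root a b z₀))) := by
  have hD := h.gaps.aeval_den_ne_zero hz
  have h1 : aeval z (num b) = root a b z ^ 2 * aeval z (den a) := by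
    rw [h.gaps.root_sq hz, quot, div_mul_cancel₀ _ hD]
  rw [h.aeval_discDen_eq, h1, ← h.gaps.root_sq h.mem_domain, map_pow]
  ring

lemma ahlforsProduct_ne_zero_iff (h : ExtremalData a b z₀ ρ) {z : ℂ} (hz : z ∈ domain a b) :
    ahlforsProduct a b z₀ z ≠ 0 ↔
      aeval z (discDen a b (root a b z₀).re (root a b z₀).im) ≠ 0 := by
  have h1 := mul_ne_zero (h.root_add_ne_zero hz) (h.root_add_conj_ne_zero hz)
  have hD := h.gaps.aeval_den_ne_zero hz
  rw [h.aeval_discDen_root hz, ← h.ahlforsProduct_mul hz]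
  simp [h1, hD, -mul_eq_zero, mul_ne_zero_iff]

lemma discriminant_eq (h : ExtremalData a b z₀ ρ) {z : ℂ} (hz : z ∈ domain a b)
    (hB : ahlforsProduct a b z₀ z ≠ 0) :
    discriminant a b z₀ z = value (discRat a b (root a b z₀).re (root a b z₀).im) z := by
  have hW := (h.ahlforsProduct_ne_zero_iff hz).mp hB
  have h1 := mul_ne_zero (h.root_add_ne_zero hz) (h.root_add_conj_ne_zero hz)
  have hD := h.gaps.aeval_den_ne_zero hz
  have hN : aeval z (num b) = root a b z ^ 2 * aeval z (den a) := by
    rw [h.gaps.root_sq hz, quot, div_mul_cancel₀ _ hD]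
  have h2 : (root a b z - root a b z₀) * (root a b z - conj (root a b z₀)) ≠ 0 := by
    rw [← h.ahlforsProduct_mul hz]
    exact mul_ne_zero hB h1
  have hB' := eq_div_of_mul_eq h1 (h.ahlforsProduct_mul hz)
  have hx : ((root a b z₀).re : ℂ) = (root a b z₀ + conj (root a b z₀)) / 2 := re_eq_add_conj _
  rw [discriminant, h.value_discRat, aeval_discNum, hB', eq_div_iff hW, add_mul,
    h.aeval_discDen_root hz, hN]
  simp only [coe_algebraMap]
  push_cast
  rw [hx]
  generalize root a b z = f at *
  generalize root a b z₀ = f₀ at *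
  generalize conj f₀ = f₁ at *
  obtain ⟨h3, h4⟩ := mul_ne_zero_iff.mp h1
  obtain ⟨h5, h6⟩ := mul_ne_zero_iff.mp h2
  field_simp
  ring

end ExtremalData

/-! ### Values on the real line -/

lemma eval_discDen (x y t : ℝ) : (discDen a b x y).eval t = (num b).eval t ^ 2
      - 2 * (x ^ 2 - y ^ 2) * ((num b).eval t * (den a).eval t)
      + (x ^ 2 + y ^ 2) ^ 2 * (den a).eval t ^ 2 := by
  simpa using aeval_discDen (a := a) (b := b) x y t

lemma eval_discNum (x y t : ℝ) : (discNum a b x y).eval t = 2 * (discDen a b x y).eval t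
      + 16 * x ^ 2 * ((num b).eval t * (den a).eval t) := by
  simpa using aeval_discNum (a := a) (b := b) x y t

/-- The reason why the discriminant is at least `-2` on the real line. -/
lemma eval_discDen_add (x y t : ℝ) :
    (discDen a b x y).eval t + 4 * x ^ 2 * ((num b).eval t * (den a).eval t) =
      ((num b).eval t + (x ^ 2 + y ^ 2) * (den a).eval t) ^ 2 := by
  rw [eval_discDen]; ring

namespace OrderedGaps

lemma eval_discDen_pos (h : OrderedGaps a b) {x y : ℝ} (hx : x ≠ 0) (hy : y ≠ 0) (t : ℝ) :
    0 < (discDen a b x y).eval t := by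
  -- on the real line the denominator is `|num - c * den|²` with `c = (x + i y)²`
  have h1 : (discDen a b x y).eval t = ((num b).eval t - (x ^ 2 - y ^ 2) * (den a).eval t) ^ 2
      + 4 * x ^ 2 * y ^ 2 * (den a).eval t ^ 2 := by
    rw [eval_discDen]; ring
  rw [h1]
  by_cases hD : (den a).eval t = 0
  · have hN := (h.num_ne_zero_or_den_ne_zero t).resolve_right (not_not.mpr hD)
    rw [hD]
    simp only [mul_zero, sub_zero]
    positivity
  · positivity

lemma eval_discNum_div (h : OrderedGaps a b) {x y : ℝ} (hx : x ≠ 0) (hy : y ≠ 0) (t : ℝ) :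
    (discNum a b x y).eval t / (discDen a b x y).eval t =
      2 + 16 * x ^ 2 * ((num b).eval t * (den a).eval t) / (discDen a b x y).eval t := by
  rw [eval_discNum, add_div, mul_div_cancel_right₀ _ (h.eval_discDen_pos hx hy t).ne']

end OrderedGaps

/-- The numerator of the derivative of the discriminant. -/
lemma eval_derivative_disc (x y t : ℝ) :
    (derivative (discNum a b x y)).eval t * (discDen a b x y).eval t
      - (discNum a b x y).eval t * (derivative (discDen a b x y)).eval t =
    16 * x ^ 2 * (((x ^ 2 + y ^ 2) * (den a).eval t - (num b).eval t) *
      ((x ^ 2 + y ^ 2) * (den a).eval t + (num b).eval t)) * wronskianEval a b t := by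
  have h1 : derivative (discDen a b x y) = C 2 * num b * derivative (num b)
      - C (2 * (x ^ 2 - y ^ 2)) * (derivative (num b) * den a + num b * derivative (den a))
      + C ((x ^ 2 + y ^ 2) ^ 2) * (C 2 * den a * derivative (den a)) := by
    rw [discDen, derivative_add, derivative_sub, derivative_C_mul, derivative_C_mul,
      derivative_mul, derivative_sq, derivative_sq]
  have h2 : derivative (discNum a b x y) = C 2 * derivative (discDen a b x y)
      + C (16 * x ^ 2) * (derivative (num b) * den a + num b * derivative (den a)) := by
    rw [discNum, show (2 : ℝ[X]) = C 2 from rfl, derivative_add, derivative_C_mul,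
      derivative_C_mul, derivative_mul]
  rw [h2, h1, eval_discNum]
  simp only [eval_add, eval_mul, eval_sub, eval_C]
  rw [eval_discDen, wronskianEval]
  ring

/-- The derivative of `num / den` on the real line. -/
lemma hasDerivAt_eval_div {t : ℝ} (hD : (den a).eval t ≠ 0) :
    HasDerivAt (fun t => (num b).eval t / (den a).eval t)
      (wronskianEval a b t / (den a).eval t ^ 2) t :=
  ((num b).hasDerivAt t).div ((den a).hasDerivAt t) hD

lemma OrderedGaps.strictAntiOn_eval_div (h : OrderedGaps a b) {s : Set ℝ} (hs : Convex ℝ s)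
    (hN : ∀ t ∈ s, (num b).eval t ≠ 0) (hD : ∀ t ∈ s, (den a).eval t ≠ 0) :
    StrictAntiOn (fun t => (num b).eval t / (den a).eval t) s := by
  refine strictAntiOn_of_deriv_neg hs
    (fun t ht => (hasDerivAt_eval_div (hD t ht)).continuousAt.continuousWithinAt) fun t ht => ?_
  have ht' := interior_subset ht
  rw [(hasDerivAt_eval_div (hD t ht')).deriv]
  have := hD t ht'
  exact div_neg_of_neg_of_pos (h.wronskianEval_neg (hN t ht') (hD t ht')) (by positivity)

namespace OrderedGaps

lemma eval_ne_zero_of_notMem (h : OrderedGaps a b) {t : ℝ} (ht : t ∉ realSet a b) :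
    (num b).eval t ≠ 0 ∧ (den a).eval t ≠ 0 :=
  mul_ne_zero_iff.mp (h.num_mul_den_pos ht).ne'

lemma eval_den_left_end (j : Fin g) : (den a).eval (a j) = 0 := by
  rw [eval_den, Finset.prod_eq_zero (Finset.mem_univ j) (sub_self _)]

lemma eval_num_bandLeft (i : Fin (g + 1)) : (num b).eval (bandLeft b i) = 0 := by
  rw [eval_num, Finset.prod_eq_zero (Finset.mem_univ i) (sub_self _), neg_zero]

lemma one_le_prod_div {f k : Fin g → ℝ} (hfk : ∀ j, 1 ≤ f j / k j) :
    1 ≤ (∏ j, f j) / ∏ j, k j := by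
  rw [← Finset.prod_div_distrib]
  exact Finset.prod_induction _ (fun t => 1 ≤ t) (fun _ _ => one_le_mul_of_one_le_of_one_le)
    le_rfl fun j _ => hfk j

/-- On the negative half-line `num / den` takes every positive value. -/
lemma exists_neg_eval_eq (h : OrderedGaps a b) {m : ℝ} (hm : 0 < m) :
    ∃ c < 0, (num b).eval c = m * (den a).eval c := by
  have hD : ∀ t ≤ (0 : ℝ), (den a).eval t ≠ 0 := fun t ht => by
    rw [eval_den, Finset.prod_ne_zero_iff]
    intro j _
    have := h.pos j
    linarith
  have hcont : ContinuousOn (fun t => (num b).eval t / (den a).eval t) (Icc (-m) 0) :=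
    fun t ht => (hasDerivAt_eval_div (hD t ht.2)).continuousAt.continuousWithinAt
  have h0 : (num b).eval 0 / (den a).eval 0 = 0 := by
    have := eval_num_bandLeft (b := b) 0
    rw [bandLeft_zero] at this
    rw [this, zero_div]
  have h1 : m ≤ (num b).eval (-m) / (den a).eval (-m) := by
    rw [eval_num, eval_den, Fin.prod_univ_succ]
    simp only [bandLeft_zero, bandLeft_succ, sub_zero]
    rw [neg_mul, neg_neg, mul_div_assoc]
    refine le_mul_of_one_le_right hm.le (one_le_prod_div fun j => ?_)
    have h2 := h.pos j
    have h3 := h.lt j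
    rw [one_le_div_of_neg (by linarith)]
    linarith
  obtain ⟨c, hc, hcm⟩ := intermediate_value_Icc' (by linarith) hcont
    (show m ∈ Icc _ _ from ⟨by rw [h0]; exact hm.le, h1⟩)
  refine ⟨c, lt_of_le_of_ne hc.2 ?_, (div_eq_iff (hD c hc.2)).mp hcm⟩
  rintro rfl
  simp only [h0] at hcm
  exact hm.ne hcm

/-- On the unbounded band `num / den` takes every negative value. -/
lemma exists_last_eval_eq (h : OrderedGaps a b) {m : ℝ} (hm : 0 < m) :
    ∃ c > bandLeft b (Fin.last g), (num b).eval c = -m * (den a).eval c := by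
  set l := bandLeft b (Fin.last g) with hl
  have hal : ∀ j, a j < l := fun j => (h.lt j).trans_le (h.le_bandLeft (by simp))
  have hD : ∀ t, l ≤ t → (den a).eval t ≠ 0 := fun t ht => by
    rw [eval_den, Finset.prod_ne_zero_iff]
    intro j _
    have := hal j
    linarith
  have hcont : ContinuousOn (fun t => (num b).eval t / (den a).eval t) (Icc l (l + m)) :=
    fun t ht => (hasDerivAt_eval_div (hD t ht.1)).continuousAt.continuousWithinAt
  have h0 : (num b).eval l / (den a).eval l = 0 := by rw [hl, eval_num_bandLeft, zero_div]
  have h1 : (num b).eval (l + m) / (den a).eval (l + m) ≤ -m := by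
    rw [eval_num, eval_den, Fin.prod_univ_castSucc, ← hl, add_sub_cancel_left, neg_div,
      mul_comm _ m, mul_div_assoc, neg_le_neg_iff]
    refine le_mul_of_one_le_right hm.le (one_le_prod_div fun j => ?_)
    have h2 := hal j
    have h3 := h.bandLeft_castSucc_lt j
    rw [one_le_div (by linarith)]
    linarith
  obtain ⟨c, hc, hcm⟩ := intermediate_value_Icc' (by linarith) hcont
    (show -m ∈ Icc _ _ from ⟨h1, by rw [h0]; linarith⟩)
  refine ⟨c, lt_of_le_of_ne hc.1 ?_, (div_eq_iff (hD c hc.1)).mp hcm⟩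
  rintro h2
  simp only [← h2, h0] at hcm
  linarith

/-- Between two zeros of `num * den` the discriminant returns to the value `2`, so that it has a
critical point. -/
lemma exists_Ioo_eval_eq (h : OrderedGaps a b) {x y : ℝ} (hx : x ≠ 0) (hy : y ≠ 0) {p q : ℝ}
    (hpq : p < q) (hp : (num b).eval p * (den a).eval p = 0)
    (hq : (num b).eval q * (den a).eval q = 0) (hN : ∀ t ∈ Ioo p q, (num b).eval t ≠ 0)
    (hD : ∀ t ∈ Ioo p q, (den a).eval t ≠ 0) :
    ∃ c ∈ Ioo p q, ((x ^ 2 + y ^ 2) * (den a).eval c - (num b).eval c) *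
      ((x ^ 2 + y ^ 2) * (den a).eval c + (num b).eval c) = 0 := by
  have hW := h.eval_discDen_pos hx hy
  have hder : ∀ t, HasDerivAt (fun t => (discNum a b x y).eval t / (discDen a b x y).eval t)
      (((derivative (discNum a b x y)).eval t * (discDen a b x y).eval t
      - (discNum a b x y).eval t * (derivative (discDen a b x y)).eval t) /
        (discDen a b x y).eval t ^ 2) t :=
    fun t => ((discNum a b x y).hasDerivAt t).div ((discDen a b x y).hasDerivAt t) (hW t).ne'
  obtain ⟨c, hc, hc0⟩ := exists_hasDerivAt_eq_zero hpq
    (fun t _ => (hder t).continuousAt.continuousWithinAt)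
    (by rw [h.eval_discNum_div hx hy, h.eval_discNum_div hx hy, hp, hq]; simp)
    (fun t _ => hder t)
  refine ⟨c, hc, ?_⟩
  rw [eval_derivative_disc, div_eq_zero_iff] at hc0
  have h1 := (h.wronskianEval_neg (hN c hc) (hD c hc)).ne
  have h2 := pow_ne_zero 2 (hW c).ne'
  simpa [h1, h2, hx] using hc0

end OrderedGaps

namespace OrderedGaps

/-! ### Bands and gaps -/

lemma gap_subset_compl (j : Fin g) : Ioo (a j) (b j) ⊆ (realSet a b)ᶜ := by
  intro t ht h1
  rcases (mem_realSet.mp h1).2 j with h2 | h2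
  · exact not_le.mpr ht.1 h2
  · exact not_le.mpr ht.2 h2

lemma Iio_subset_compl : Iio 0 ⊆ (realSet a b)ᶜ :=
  fun _ ht h1 => not_le.mpr ht (mem_realSet.mp h1).1

lemma lt_of_mem_band {i : Fin (g + 1)} {t : ℝ} (ht : t ∈ band a b i) : bandLeft b i < t := ht.1

lemma lt_left_end_of_mem_band (h : OrderedGaps a b) {i : Fin (g + 1)} {t : ℝ}
    (ht : t ∈ band a b i) {k : Fin g} (hk : i.val ≤ k.val) : t < a k :=
  (ht.2 (hk.trans_lt k.isLt)).trans_le (h.le_left_end (Fin.le_def.mpr hk))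

lemma band_subset_realSet (h : OrderedGaps a b) (i : Fin (g + 1)) :
    band a b i ⊆ realSet a b := by
  intro t ht
  refine mem_realSet.mpr ⟨(h.bandLeft_nonneg i).trans (lt_of_mem_band ht).le, fun k => ?_⟩
  rcases lt_or_ge k.val i.val with hk | hk
  · exact Or.inr ((h.le_bandLeft hk).trans (lt_of_mem_band ht).le)
  · exact Or.inl (h.lt_left_end_of_mem_band ht hk).le

lemma eval_den_ne_zero_of_mem_band (h : OrderedGaps a b) {i : Fin (g + 1)} {t : ℝ}
    (ht : t ∈ band a b i) : (den a).eval t ≠ 0 := by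
  rw [eval_den, Finset.prod_ne_zero_iff]
  intro k _
  rcases lt_or_ge k.val i.val with hk | hk
  · have := (h.lt k).trans_le ((h.le_bandLeft hk).trans (lt_of_mem_band ht).le)
    linarith
  · have := h.lt_left_end_of_mem_band ht hk
    linarith

lemma eval_num_ne_zero_of_mem_band (h : OrderedGaps a b) {i : Fin (g + 1)} {t : ℝ}
    (ht : t ∈ band a b i) : (num b).eval t ≠ 0 := by
  have hi := lt_of_mem_band ht
  rw [eval_num, neg_ne_zero, Finset.prod_ne_zero_iff]
  intro k _
  induction k using Fin.cases with
  | zero =>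
    have := h.bandLeft_nonneg i
    rw [bandLeft_zero]
    linarith
  | succ k =>
    rw [bandLeft_succ]
    rcases lt_or_ge k.val i.val with hk | hk
    · have := h.le_bandLeft hk
      linarith
    · have := (h.lt_left_end_of_mem_band ht hk).trans (h.lt k)
      linarith

lemma convex_band (i : Fin (g + 1)) : Convex ℝ (band a b i) := by
  refine OrdConnected.convex ⟨fun s hs t ht u hu => ⟨hs.1.trans_le hu.1, fun hi => ?_⟩⟩
  exact hu.2.trans_lt (ht.2 hi)

end OrderedGaps

namespace ExtremalData

variable {z₀ : ℂ} {ρ : Fin g → ℂ}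

lemma value_ofReal (h : ExtremalData a b z₀ ρ) (t : ℝ) :
    value (discRat a b (root a b z₀).re (root a b z₀).im) t =
      (((discNum a b (root a b z₀).re (root a b z₀).im).eval t /
        (discDen a b (root a b z₀).re (root a b z₀).im).eval t : ℝ) : ℂ) := by
  rw [h.value_discRat, aeval_ofReal_eq, aeval_ofReal_eq, ofReal_div]

lemma re_ne_zero (h : ExtremalData a b z₀ ρ) : (root a b z₀).re ≠ 0 :=
  (h.gaps.root_re_pos h.mem_domain).ne'

lemma im_ne_zero (h : ExtremalData a b z₀ ρ) : (root a b z₀).im ≠ 0 :=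
  (h.gaps.root_im_neg h.im_pos).ne

lemma not_isPole_ofReal (h : ExtremalData a b z₀ ρ) (t : ℝ) :
    ¬ IsPole (discRat a b (root a b z₀).re (root a b z₀).im) t := by
  rw [h.isPole_discRat, aeval_ofReal_eq]
  exact_mod_cast (h.gaps.eval_discDen_pos h.re_ne_zero h.im_ne_zero t).ne'

lemma isCritical_iff (h : ExtremalData a b z₀ ρ) {t : ℝ} (hN : (num b).eval t ≠ 0)
    (hD : (den a).eval t ≠ 0) :
    IsCritical (discRat a b (root a b z₀).re (root a b z₀).im) t ↔
      (((root a b z₀).re ^ 2 + (root a b z₀).im ^ 2) * (den a).eval t - (num b).eval t) *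
      (((root a b z₀).re ^ 2 + (root a b z₀).im ^ 2) * (den a).eval t + (num b).eval t) = 0 := by
  have hx := h.re_ne_zero
  have hW := (h.gaps.eval_discDen_pos hx h.im_ne_zero t).ne'
  set x := (root a b z₀).re
  set y := (root a b z₀).im
  have hWc : aeval (t : ℂ) (discDen a b x y) ≠ 0 := by
    rw [aeval_ofReal_eq]
    exact_mod_cast hW
  have h1 : HasDerivAt (value (discRat a b x y))
      (((((derivative (discNum a b x y)).eval t * (discDen a b x y).eval t
      - (discNum a b x y).eval t * (derivative (discDen a b x y)).eval t) /
        (discDen a b x y).eval t ^ 2 : ℝ)) : ℂ) t := by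
    have := ((discNum a b x y).hasDerivAt_aeval (t : ℂ)).div
      ((discDen a b x y).hasDerivAt_aeval (t : ℂ)) hWc
    simp only [aeval_ofReal_eq] at this
    push_cast
    refine this.congr_of_eventuallyEq (Eventually.of_forall fun z => ?_)
    exact h.value_discRat z
  have hw := (h.gaps.wronskianEval_neg hN hD).ne
  have h2 : IsCritical (discRat a b x y) t ↔
      ((derivative (discNum a b x y)).eval t * (discDen a b x y).eval t
      - (discNum a b x y).eval t * (derivative (discDen a b x y)).eval t) /
        (discDen a b x y).eval t ^ 2 = 0 := by
    constructor
    · intro hc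
      exact_mod_cast h1.unique hc.2
    · intro hc
      rw [hc, ofReal_zero] at h1
      exact ⟨h.not_isPole_ofReal t, h1⟩
  rw [h2, eval_derivative_disc]
  simp [hw, hW, hx]

/-- On an interval in the gaps the critical points are the points where `num / den = |f₀|²`. -/
lemma critical_gap (h : ExtremalData a b z₀ ρ) {s : Set ℝ} (hs : Convex ℝ s)
    (hsE : s ⊆ (realSet a b)ᶜ) {c : ℝ} (hc : c ∈ s)
    (hcm : (((root a b z₀).re ^ 2 + (root a b z₀).im ^ 2) * (den a).eval c - (num b).eval c) *
      (((root a b z₀).re ^ 2 + (root a b z₀).im ^ 2) * (den a).eval c + (num b).eval c) = 0) :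
    (∀ x ∈ s, IsCritical (discRat a b (root a b z₀).re (root a b z₀).im) (x : ℂ) ↔ x = c) ∧
      ∃ v : ℝ, 2 < v ∧
        value (discRat a b (root a b z₀).re (root a b z₀).im) (c : ℂ) = (v : ℂ) := by
  have hx := h.re_ne_zero
  have hy := h.im_ne_zero
  have hN : ∀ t ∈ s, (num b).eval t ≠ 0 := fun t ht => (h.gaps.eval_ne_zero_of_notMem (hsE ht)).1
  have hD : ∀ t ∈ s, (den a).eval t ≠ 0 := fun t ht => (h.gaps.eval_ne_zero_of_notMem (hsE ht)).2
  have hpos : ∀ t ∈ s, 0 < (num b).eval t * (den a).eval t := fun t ht =>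
    h.gaps.num_mul_den_pos (hsE ht)
  have hW := h.gaps.eval_discDen_pos hx hy c
  have hval := h.value_ofReal c
  have hcrit := fun t ht => h.isCritical_iff (hN t ht) (hD t ht)
  rw [h.gaps.eval_discNum_div hx hy] at hval
  set x := (root a b z₀).re
  set y := (root a b z₀).im
  have key : ∀ t ∈ s, ((x ^ 2 + y ^ 2) * (den a).eval t - (num b).eval t) *
      ((x ^ 2 + y ^ 2) * (den a).eval t + (num b).eval t) = 0 ↔
      (num b).eval t / (den a).eval t = x ^ 2 + y ^ 2 := by
    intro t ht
    have h1 : (x ^ 2 + y ^ 2) * (den a).eval t + (num b).eval t ≠ 0 := fun h1 => by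
      have h2 := hpos t ht
      have h3 : (num b).eval t = -((x ^ 2 + y ^ 2) * (den a).eval t) := by linarith
      rw [h3] at h2
      nlinarith [mul_nonneg (add_nonneg (sq_nonneg x) (sq_nonneg y)) (sq_nonneg ((den a).eval t))]
    rw [mul_eq_zero, or_iff_left h1, sub_eq_zero, div_eq_iff (hD t ht), eq_comm]
  refine ⟨fun t ht => ?_, _, ?_, hval⟩
  · rw [hcrit t ht, key t ht]
    constructor
    · intro h1
      refine (h.gaps.strictAntiOn_eval_div hs hN hD).injOn ht hc ?_
      exact h1.trans ((key c hc).mp hcm).symm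
    · rintro rfl
      exact (key _ hc).mp hcm
  · have := hpos c hc
    have : 0 < 16 * x ^ 2 * ((num b).eval c * (den a).eval c) / (discDen a b x y).eval c := by
      positivity
    linarith

/-- On an interval in the bands the critical points are the points where `num / den = -|f₀|²`. -/
lemma critical_band (h : ExtremalData a b z₀ ρ) {s : Set ℝ} (hs : Convex ℝ s)
    (hsE : s ⊆ realSet a b) (hN : ∀ t ∈ s, (num b).eval t ≠ 0) (hD : ∀ t ∈ s, (den a).eval t ≠ 0)
    {c : ℝ} (hc : c ∈ s)
    (hcm : (((root a b z₀).re ^ 2 + (root a b z₀).im ^ 2) * (den a).eval c - (num b).eval c) *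
      (((root a b z₀).re ^ 2 + (root a b z₀).im ^ 2) * (den a).eval c + (num b).eval c) = 0) :
    (∀ x ∈ s, IsCritical (discRat a b (root a b z₀).re (root a b z₀).im) (x : ℂ) ↔ x = c) ∧
      value (discRat a b (root a b z₀).re (root a b z₀).im) (c : ℂ) = -2 := by
  have hx := h.re_ne_zero
  have hy := h.im_ne_zero
  have hneg : ∀ t ∈ s, (num b).eval t * (den a).eval t < 0 := fun t ht =>
    lt_of_le_of_ne (h.gaps.num_mul_den_nonpos (hsE ht)) (mul_ne_zero (hN t ht) (hD t ht))
  have hW := h.gaps.eval_discDen_pos hx hy c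
  have hval := h.value_ofReal c
  have hcrit := fun t ht => h.isCritical_iff (hN t ht) (hD t ht)
  set x := (root a b z₀).re
  set y := (root a b z₀).im
  have key : ∀ t ∈ s, ((x ^ 2 + y ^ 2) * (den a).eval t - (num b).eval t) *
      ((x ^ 2 + y ^ 2) * (den a).eval t + (num b).eval t) = 0 ↔
      (num b).eval t / (den a).eval t = -(x ^ 2 + y ^ 2) := by
    intro t ht
    have h1 : (x ^ 2 + y ^ 2) * (den a).eval t - (num b).eval t ≠ 0 := fun h1 => by
      have h2 := hneg t ht
      have h3 : (num b).eval t = (x ^ 2 + y ^ 2) * (den a).eval t := by linarith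
      rw [h3] at h2
      nlinarith [mul_nonneg (add_nonneg (sq_nonneg x) (sq_nonneg y)) (sq_nonneg ((den a).eval t))]
    rw [mul_eq_zero, or_iff_right h1, div_eq_iff (hD t ht), neg_mul, ← eq_neg_iff_add_eq_zero]
    constructor <;> intro h4 <;> linarith
  have hcm' := (key c hc).mp hcm
  refine ⟨fun t ht => ?_, ?_⟩
  · rw [hcrit t ht, key t ht]
    constructor
    · intro h1
      exact (h.gaps.strictAntiOn_eval_div hs hN hD).injOn ht hc (h1.trans hcm'.symm)
    · rintro rfl
      exact hcm'
  · rw [div_eq_iff (hD c hc)] at hcm'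
    have h1 := eval_discDen_add (a := a) (b := b) x y c
    have h2 : (discNum a b x y).eval c / (discDen a b x y).eval c = -2 := by
      rw [div_eq_iff hW.ne', eval_discNum]
      rw [show (num b).eval c + (x ^ 2 + y ^ 2) * (den a).eval c = 0 by linarith] at h1
      linarith
    rw [hval, h2]
    norm_num

/-! ### Zeros of the Ahlfors function, boundary limits, and the preimage of `[-2, 2]` -/

lemma analyticOrderAt_prod_sub {s : Finset (Fin g)} (r : Fin g → ℂ) (z : ℂ) :
    analyticOrderAt (fun z => ∏ k ∈ s, (z - r k)) z = ((s.val.map r).count z : ℕ∞) := by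
  induction s using Finset.induction_on with
  | empty => simp [analyticOrderAt_eq_zero]
  | insert k s hk ih =>
    have h1 : (fun z : ℂ => ∏ k ∈ insert k s, (z - r k)) =
        (fun z => z - r k) * fun z => ∏ k ∈ s, (z - r k) := by
      ext z; simp [Finset.prod_insert hk]
    rw [h1, analyticOrderAt_mul (by fun_prop) (by fun_prop), ih, Finset.insert_val_of_notMem hk,
      Multiset.map_cons, Multiset.count_cons, Nat.cast_add, add_comm]
    congr 1
    by_cases hz : z = r k
    · rw [if_pos hz, hz]
      exact_mod_cast analyticOrderAt_id_sub_const_self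
    · rw [if_neg hz]
      exact_mod_cast analyticOrderAt_id_sub_const_of_ne hz

lemma analyticOrderAt_ahlforsFunction (h : ExtremalData a b z₀ ρ) {z : ℂ} (hz : z.im < 0) :
    analyticOrderAt (ahlforsFunction (domain a b) z₀) z =
      ((Finset.univ.val.map ρ).count z : ℕ∞) := by
  have hzd : z ∈ domain a b := mem_domain_of_im_ne_zero hz.ne
  have hn := isOpen_domain.mem_nhds hzd
  let v : ℂ → ℂ := fun z => root a b z₀ / ‖root a b z₀‖ * (z - z₀) /
    (aeval z (den a) * ((root a b z + root a b z₀) * (root a b z + conj (root a b z₀))))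
  have hne : ∀ z ∈ domain a b, aeval z (den a) *
      ((root a b z + root a b z₀) * (root a b z + conj (root a b z₀))) ≠ 0 := fun z hz =>
    mul_ne_zero (h.gaps.aeval_den_ne_zero hz)
      (mul_ne_zero (h.root_add_ne_zero hz) (h.root_add_conj_ne_zero hz))
  have hvd : DifferentiableOn ℂ v (domain a b) := by
    have hr := h.gaps.differentiableOn_root
    have hD : Differentiable ℂ fun z : ℂ => aeval z (den a) := Polynomial.differentiable_aeval _
    refine DifferentiableOn.div ?_ ?_ hne
    · exact ((differentiable_id.sub_const z₀).const_mul _).differentiableOn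
    · exact hD.differentiableOn.mul ((hr.add_const _).mul (hr.add_const _))
  have hva : AnalyticAt ℂ v z := hvd.analyticAt hn
  have hv0 : v z ≠ 0 := by
    refine div_ne_zero (mul_ne_zero ?_ (sub_ne_zero.mpr ?_)) (hne z hzd)
    · exact norm_ne_zero_iff.mp (by rw [h.norm_unimodular]; exact one_ne_zero)
    · rintro rfl
      exact absurd hz (not_lt.mpr h.im_pos.le)
  have heq : ahlforsFunction (domain a b) z₀ =ᶠ[𝓝 z] v * fun z => ∏ k, (z - ρ k) := by
    filter_upwards [hn] with u hu
    rw [h.ahlforsFunction_eqOn hu, extremal, Pi.mul_apply]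
    simp only [v]
    ring
  rw [analyticOrderAt_congr heq, analyticOrderAt_mul hva (by fun_prop),
    hva.analyticOrderAt_eq_zero.mpr hv0, zero_add, analyticOrderAt_prod_sub]

lemma tendsto_discriminant (h : ExtremalData a b z₀ ρ) {z : ℂ} (hz : z ∈ complexSet a b) :
    Tendsto (discriminant a b z₀) (𝓝[domain a b] z)
      (𝓝 (value (discRat a b (root a b z₀).re (root a b z₀).im) z)) := by
  obtain ⟨t, ht, rfl⟩ := hz
  have hW : aeval (t : ℂ) (discDen a b (root a b z₀).re (root a b z₀).im) ≠ 0 := by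
    rw [Ne, ← h.isPole_discRat]
    exact h.not_isPole_ofReal t
  have hcW : Continuous fun z : ℂ => aeval z (discDen a b (root a b z₀).re (root a b z₀).im) :=
    Polynomial.continuous_aeval _
  have hcN : Continuous fun z : ℂ => aeval z (discNum a b (root a b z₀).re (root a b z₀).im) :=
    Polynomial.continuous_aeval _
  have h1 : Tendsto (value (discRat a b (root a b z₀).re (root a b z₀).im)) (𝓝 (t : ℂ))
      (𝓝 (value (discRat a b (root a b z₀).re (root a b z₀).im) t)) := by
    have := (hcN.tendsto (t : ℂ)).div (hcW.tendsto (t : ℂ)) hW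
    rw [h.value_discRat]
    exact this.congr fun z => (h.value_discRat z).symm
  refine (h1.mono_left nhdsWithin_le_nhds).congr' ?_
  filter_upwards [self_mem_nhdsWithin, nhdsWithin_le_nhds (hcW.continuousAt.eventually_ne hW)]
    with u hu hu'
  exact (h.discriminant_eq hu ((h.ahlforsProduct_ne_zero_iff hu).mpr hu')).symm

/-- If `F² + s F + m² = 0` with `s ≥ 2 m > 0`, then `F` is a negative real number. -/
lemma notMem_slitPlane_of_quadratic {F : ℂ} {s m : ℝ} (hm : 0 < m) (hs : 2 * m ≤ s)
    (hF : F ^ 2 + s * F + m ^ 2 = 0) : F ∉ slitPlane := by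
  have hre := congrArg Complex.re hF
  have him := congrArg Complex.im hF
  simp only [pow_two, add_re, mul_re, ofReal_re, ofReal_im, zero_mul, sub_zero, zero_re, add_im,
    mul_im, add_zero, mul_zero, zero_im] at hre him
  have him0 : F.im = 0 := by
    have h1 : F.im * (2 * F.re + s) = 0 := by linarith
    rcases mul_eq_zero.mp h1 with h2 | h2
    · exact h2
    · have h3 : s = -2 * F.re := by linarith
      rw [h3] at hre hs
      nlinarith [sq_nonneg F.im]
  rw [mem_slitPlane_iff, not_or, not_lt, not_not]
  refine ⟨?_, him0⟩
  rw [him0] at hre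
  by_contra! hc
  nlinarith

lemma preimage_eq (h : ExtremalData a b z₀ ρ) :
    {z : ℂ | ¬ IsPole (discRat a b (root a b z₀).re (root a b z₀).im) z ∧
      ∃ t ∈ Icc (-2 : ℝ) 2,
        value (discRat a b (root a b z₀).re (root a b z₀).im) z = (t : ℂ)} = complexSet a b := by
  have hx := h.re_ne_zero
  have hy := h.im_ne_zero
  ext z
  constructor
  · rintro ⟨hW, t, ht, hval⟩
    by_contra hz
    have hzd : z ∈ domain a b := hz
    rw [h.isPole_discRat] at hW
    rw [h.value_discRat, div_eq_iff hW, aeval_discNum, aeval_discDen] at hval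
    have hN := h.gaps.aeval_num_ne_zero hzd
    have hD := h.gaps.aeval_den_ne_zero hzd
    have hq := h.gaps.quot_mem_slitPlane hzd
    set x := (root a b z₀).re
    set y := (root a b z₀).im
    simp only [coe_algebraMap] at hval
    have ht2 : t ≠ 2 := by
      rintro rfl
      have h1 : ((16 * x ^ 2 : ℝ) : ℂ) * (aeval z (num b) * aeval z (den a)) = 0 := by
        push_cast at hval ⊢
        linear_combination hval
      have h2 : ((16 * x ^ 2 : ℝ) : ℂ) ≠ 0 := by
        exact_mod_cast (by positivity : (16 * x ^ 2 : ℝ) ≠ 0)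
      exact mul_ne_zero h2 (mul_ne_zero hN hD) h1
    have hlt : 0 < 2 - t := sub_pos.mpr (lt_of_le_of_ne ht.2 ht2)
    have hltc : ((2 - t : ℝ) : ℂ) ≠ 0 := by exact_mod_cast hlt.ne'
    refine notMem_slitPlane_of_quadratic (F := quot a b z) (m := x ^ 2 + y ^ 2)
      (s := 16 * x ^ 2 / (2 - t) - 2 * (x ^ 2 - y ^ 2)) (by positivity) ?_ ?_ hq
    · have h1 : 4 * x ^ 2 ≤ 16 * x ^ 2 / (2 - t) := by
        rw [le_div_iff₀ hlt]
        nlinarith [sq_nonneg x, ht.1]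
      linarith
    · rw [quot]
      push_cast at hval hltc ⊢
      field_simp
      linear_combination hval
  · rintro ⟨t, ht, rfl⟩
    refine ⟨h.not_isPole_ofReal t, _, ?_, h.value_ofReal t⟩
    have hW := h.gaps.eval_discDen_pos hx hy t
    have h1 := h.gaps.num_mul_den_nonpos ht
    have h2 := eval_discDen_add (a := a) (b := b) (root a b z₀).re (root a b z₀).im t
    have h3 := mul_nonneg (sq_nonneg (root a b z₀).re) (neg_nonneg.mpr h1)
    constructor
    · rw [le_div_iff₀ hW, eval_discNum]
      nlinarith [sq_nonneg ((num b).eval t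
        + ((root a b z₀).re ^ 2 + (root a b z₀).im ^ 2) * (den a).eval t)]
    · rw [div_le_iff₀ hW, eval_discNum]
      linarith

end ExtremalData

end Denjoy

theorem mainTheorem9 (g : ℕ) (a b : Fin g → ℝ) (ha : ∀ j, 0 < a j) (hab : ∀ j, a j < b j)
    (hsep : ∀ j k, j < k → b j < a k) (z₀ : ℂ) (hz₀ : 0 < z₀.im) :
    ∃ R : RatFunc ℝ,
      -- the discriminant is the rational function `R` on the domain, and, by limits, on the set
      (∀ z ∈ Denjoy.domain a b, Denjoy.ahlforsProduct a b z₀ z ≠ 0 →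
        Denjoy.discriminant a b z₀ z = Denjoy.value R z) ∧
      (∀ z ∈ Denjoy.complexSet a b,
        Filter.Tendsto (Denjoy.discriminant a b z₀) (nhdsWithin z (Denjoy.domain a b))
          (nhds (Denjoy.value R z))) ∧
      -- it is real
      (∀ z : ℂ, Denjoy.value R z = conj (Denjoy.value R (conj z))) ∧
      -- its poles, with multiplicities
      (∃ ζ : Fin g → ℂ,
        (∀ k, 0 < (ζ k).im) ∧
        (∀ z : ℂ, z.im < 0 →
          analyticOrderAt (Denjoy.ahlforsFunction (Denjoy.domain a b) z₀) z =
            ((Finset.univ.val.map (fun k => conj (ζ k))).count z : ℕ∞)) ∧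
        R.denom.aroots ℂ =
          {z₀, conj z₀} + Finset.univ.val.map ζ + Finset.univ.val.map (fun k => conj (ζ k))) ∧
      -- the preimage of `[-2, 2]`
      {z : ℂ | ¬ Denjoy.IsPole R z ∧ ∃ t ∈ Set.Icc (-2 : ℝ) 2, Denjoy.value R z = (t : ℂ)} =
        Denjoy.complexSet a b ∧
      -- the unbounded gap
      (∃ c ∈ Set.Iio (0 : ℝ), (∀ x ∈ Set.Iio (0 : ℝ), Denjoy.IsCritical R (x : ℂ) ↔ x = c) ∧
        ∃ v : ℝ, 2 < v ∧ Denjoy.value R (c : ℂ) = (v : ℂ)) ∧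
      -- the bounded gaps
      (∀ j, ∃ c ∈ Set.Ioo (a j) (b j),
        (∀ x ∈ Set.Ioo (a j) (b j), Denjoy.IsCritical R (x : ℂ) ↔ x = c) ∧
        ∃ v : ℝ, 2 < v ∧ Denjoy.value R (c : ℂ) = (v : ℂ)) ∧
      -- the bands
      (∀ j, ∃ c ∈ Denjoy.band a b j,
        (∀ x ∈ Denjoy.band a b j, Denjoy.IsCritical R (x : ℂ) ↔ x = c) ∧
        Denjoy.value R (c : ℂ) = -2) := by
  have hgaps : Denjoy.OrderedGaps a b := ⟨ha, hab, hsep⟩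
  obtain ⟨ρ, hρ, hfac⟩ := hgaps.exists_zeros hz₀
  have h : Denjoy.ExtremalData a b z₀ ρ := ⟨hgaps, hz₀, hρ, hfac⟩
  have hx := h.re_ne_zero
  have hy := h.im_ne_zero
  have hm : 0 < (Denjoy.root a b z₀).re ^ 2 + (Denjoy.root a b z₀).im ^ 2 := by positivity
  refine ⟨Denjoy.discRat a b (Denjoy.root a b z₀).re (Denjoy.root a b z₀).im,
    fun z hz hB => h.discriminant_eq hz hB, fun z hz => h.tendsto_discriminant hz, fun z => ?_,
    ⟨fun k => conj (ρ k), fun k => by simpa using hρ k, fun z hz => ?_, ?_⟩, h.preimage_eq,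
    ?_, fun j => ?_, fun i => ?_⟩
  · rw [h.value_discRat, h.value_discRat, Denjoy.aeval_conj_real, Denjoy.aeval_conj_real,
      map_div₀, Complex.conj_conj, Complex.conj_conj]
  · simp only [Complex.conj_conj]
    exact h.analyticOrderAt_ahlforsFunction hz
  · rw [h.discRat_denom, h.aroots_discDen]
    simp only [Complex.conj_conj]
  · obtain ⟨c, hc, hcm⟩ := hgaps.exists_neg_eval_eq hm
    exact ⟨c, hc, h.critical_gap (convex_Iio 0) Denjoy.OrderedGaps.Iio_subset_compl hc
      (by rw [hcm, sub_self, zero_mul])⟩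
  · have hsub := Denjoy.OrderedGaps.gap_subset_compl (a := a) (b := b) j
    obtain ⟨c, hc, hcm⟩ := hgaps.exists_Ioo_eval_eq hx hy (hab j)
      (by rw [Denjoy.OrderedGaps.eval_den_left_end, mul_zero])
      (by rw [← Denjoy.bandLeft_succ (b := b), Denjoy.OrderedGaps.eval_num_bandLeft, zero_mul])
      (fun t ht => (hgaps.eval_ne_zero_of_notMem (hsub ht)).1)
      (fun t ht => (hgaps.eval_ne_zero_of_notMem (hsub ht)).2)
    exact ⟨c, hc, h.critical_gap (convex_Ioo _ _) hsub hc hcm⟩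
  · suffices hex : ∃ c ∈ Denjoy.band a b i,
        (((Denjoy.root a b z₀).re ^ 2 + (Denjoy.root a b z₀).im ^ 2)
            * (Denjoy.den a).eval c - (Denjoy.num b).eval c) *
          (((Denjoy.root a b z₀).re ^ 2 + (Denjoy.root a b z₀).im ^ 2)
            * (Denjoy.den a).eval c + (Denjoy.num b).eval c) = 0 by
      obtain ⟨c, hc, hcm⟩ := hex
      exact ⟨c, hc, h.critical_band (Denjoy.OrderedGaps.convex_band i)
        (hgaps.band_subset_realSet i) (fun t ht => hgaps.eval_num_ne_zero_of_mem_band ht)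
        (fun t ht => hgaps.eval_den_ne_zero_of_mem_band ht) hc hcm⟩
    induction i using Fin.lastCases with
    | last =>
      obtain ⟨c, hc, hcm⟩ := hgaps.exists_last_eval_eq hm
      refine ⟨c, ⟨hc, fun hlt => absurd hlt (by simp)⟩, ?_⟩
      rw [hcm]
      ring
    | cast k =>
      have hband : ∀ t ∈ Set.Ioo (Denjoy.bandLeft b k.castSucc) (a k),
          t ∈ Denjoy.band a b k.castSucc := fun t ht => ⟨ht.1, fun _ => ht.2⟩
      obtain ⟨c, hc, hcm⟩ := hgaps.exists_Ioo_eval_eq hx hy (hgaps.bandLeft_castSucc_lt k)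
        (by rw [Denjoy.OrderedGaps.eval_num_bandLeft, zero_mul])
        (by rw [Denjoy.OrderedGaps.eval_den_left_end, mul_zero])
        (fun t ht => hgaps.eval_num_ne_zero_of_mem_band (hband t ht))
        (fun t ht => hgaps.eval_den_ne_zero_of_mem_band (hband t ht))
      exact ⟨c, hband c hc, hcm⟩
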